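/- **Setting.** Let $f(x)=\frac1n\sum_{i=1}^n f_i(x)$ on $\mathbb R^d$, where each $f_i$ is differentiable with $L_1$-Lipschitz gradient and twice differentiable with $L_2$-Lipschitz Hessian (spectral norm), and let $\epsilon_H,\delta\in(0,1)$, $L_1>0$, $L_2\ge 0$. For the decrease bounds below assume moreover that $f$ is three times differentiable with $\|\nabla^3 f(x)-\nabla^3 f(y)\|_F\le L_3\|x-y\|_2$ for all $x,y$, where $L_3>0$, and put $\eta=\sqrt{3\epsilon_H/L_3}$. *Oracles.* A randomized oracle algorithm draws a random seed and then makes adaptive oracle calls. One call to the stochastic gradient oracle returns $\nabla f_i(y)$, and one call to the stochastic Hessian-vector oracle returns $\nabla^2 f_i(y)u$, for chosen $i,y,u$. Runtime is the number of oracle calls, counted in units of the cost $\mathbb T_g$ of a stochastic gradient or $\mathbb T_h$ of a stochastic Hessian-vector product. *Subroutine.* An ApproxNC procedure at $x$, with parameters $\epsilon_H,\delta$, is a randomized oracle algorithm whose output $\hat v$ is a unit vector or $\bot$ such that, with probability at least $1-\delta$, either $\hat v=\bot$ and $\lambda_{\min}(\nabla^2 f(x))\ge-\epsilon_H$, or $\hat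 v\neq\bot$ and $\hat v^\top\nabla^2 f(x)\hat v\le-\epsilon_H/2$. *Algorithm NCD3-FiniteSum.* Run ApproxNC at $x$. If $\hat v=\bot$, return $\bot$ (the iterate then stays at $x$, so $f(\hat y)-f(x)$ is read as $0$). Otherwise draw a sign $\zeta=\pm1$ with probability $1/2$ each, independently of $\hat v$, and return $\hat y=x+\zeta\eta\hat v$. **Lemma 4.3.** 1. Let $\lambda_{\min}(\nabla^2 f(x))<-\epsilon_H$. For every ApproxNC procedure at $x$, NCD3-FiniteSum has the following properties. With probability at least $1-\delta$ over the randomness of ApproxNC it returns a point $\hat y\ne\bot$ such that $$\mathbb E_\zeta[f(x)-f(\hat y)]\ \ge\ \frac{3\epsilon_H^2}{8L_3}.$$ If $\delta\le \epsilon_H/(3\epsilon_H+8L_1)$, then, over all randomness of the algorithm, $$\mathbb E[f(\hat y)-f(x)]\ \le\ -\frac{\epsilon_H^2}{8L_3}.$$ It makes exactly the oracle calls that ApproxNC makes. 2. There are an ApproxNC procedure that uses only stochastic Hessian-vector products, and another that uses only stochastic gradients, each depending only on $d,n,L_1,L_2,\epsilon_H,\delta$ and valid for all $f_1,\dots,f_n$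 as above and all $x\in\mathbb R^d$, such that NCD3-FiniteSum with either of them always makes at most $$C\Big(n+n^{3/4}\sqrt{L_1/\epsilon_H}\Big)\log^k\!\Big(2+\frac{n\,d\,L_1}{\epsilon_H\,\delta}\Big)=\widetilde O\Big(n+n^{3/4}\sqrt{L_1/\epsilon_H}\Big)$$ oracle calls, where $C$ and $k$ are absolute constants. When $\lambda_{\min}(\nabla^2 f(x))<-\epsilon_H$, NCD3-FiniteSum with either of them satisfies both decrease bounds of part 1, the second one already if $\delta\le\epsilon_H/(3\epsilon_H+8L_1)$ or $\delta\le\epsilon_H/(3\epsilon_H+8L_2)$. -/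

import Mathlib

open MeasureTheory

noncomputable section

namespace NCD3

/-- `ℝ^d` with the Euclidean norm. -/
abbrev E (d : ℕ) : Type := EuclideanSpace ℝ (Fin d)

section Smoothness

variable {d : ℕ}

/-- The Hessian `∇²f(x)` as an operator: the derivative of the gradient field. The operator norm on
`E d →L[ℝ] E d` is the spectral norm. -/
def hess (f : E d → ℝ) (x : E d) : E d →L[ℝ] E d :=
  fderiv ℝ (fun y => gradient f y) x

/-- The entry `∂³f(x) / ∂xᵢ∂xⱼ∂xₖ` of the third-order derivative tensor. -/
def third (f : E d → ℝ) (x : E d) (i j k : Fin d) : ℝ :=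
  (fderiv ℝ (hess f) x (EuclideanSpace.single i 1) (EuclideanSpace.single j 1)) k

/-- `f` is differentiable with `L`-Lipschitz gradient. -/
def IsSmooth (L : ℝ) (f : E d → ℝ) : Prop :=
  Differentiable ℝ f ∧ ∀ x y, ‖gradient f x - gradient f y‖ ≤ L * ‖x - y‖

/-- `f` is twice differentiable with `L`-Lipschitz Hessian (in spectral norm). -/
def IsHessianLipschitz (L : ℝ) (f : E d → ℝ) : Prop :=
  Differentiable ℝ f ∧ Differentiable ℝ (fun y => gradient f y) ∧
    ∀ x y, ‖hess f x - hess f y‖ ≤ L * ‖x - y‖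

/-- `f` is thrice differentiable and its third derivative is `L`-Lipschitz in Frobenius norm. -/
def IsThirdLipschitz (L : ℝ) (f : E d → ℝ) : Prop :=
  Differentiable ℝ f ∧ Differentiable ℝ (fun y => gradient f y) ∧ Differentiable ℝ (hess f) ∧
    ∀ x y, √(∑ i, ∑ j, ∑ k, (third f x i j k - third f y i j k) ^ 2) ≤ L * ‖x - y‖

/-- The smallest eigenvalue of an operator on `ℝ^d` (used for Hessians, which are symmetric). -/
def lambdaMin (T : E d →L[ℝ] E d) : ℝ :=
  sInf {μ : ℝ | Module.End.HasEigenvalue (T : E d →ₗ[ℝ] E d) μ}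

/-- The finite-sum objective `f = (1/n) ∑ᵢ fᵢ`. -/
def avg {n : ℕ} (F : Fin n → E d → ℝ) (x : E d) : ℝ :=
  (1 / (n : ℝ)) * ∑ i, F i x

end Smoothness

section Oracle

/-- A deterministic adaptive program that asks queries `q : Q` of an oracle, receives answers in `R`
and finally returns an element of `α`. -/
inductive Prog (Q R α : Type) : Type where
  | ret (a : α) : Prog Q R α
  | ask (q : Q) (k : R → Prog Q R α) : Prog Q R α

variable {Q R α β : Type}

/-- The value returned when the queries are answered by `O`. -/
def Prog.result (O : Q → R) : Prog Q R α → α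
  | .ret a => a
  | .ask q k => (k (O q)).result O

/-- The number of oracle calls made when the queries are answered by `O`. -/
def Prog.calls (O : Q → R) : Prog Q R α → ℕ
  | .ret _ => 0
  | .ask q k => (k (O q)).calls O + 1

/-- Sequential composition of programs. -/
def Prog.bind : Prog Q R α → (α → Prog Q R β) → Prog Q R β
  | .ret a, g => g a
  | .ask q k, g => .ask q fun r => (k r).bind g

/-- A randomized oracle algorithm: a random seed, drawn from a probability space, selects a
deterministic adaptive oracle program. -/
structure RandAlg (Q R α : Type) : Type 1 where
  /-- the space of random seeds -/
  Ω : Type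
  /-- its measurable sets -/
  mΩ : MeasurableSpace Ω
  /-- the law of the seed -/
  P : Measure Ω
  /-- the law is a probability measure -/
  prob : IsProbabilityMeasure P
  /-- the program that is run on a given seed -/
  prog : Ω → Prog Q R α

attribute [instance] RandAlg.mΩ RandAlg.prob

/-- The random output against the oracle `O`. -/
def RandAlg.output (A : RandAlg Q R α) (O : Q → R) (ω : A.Ω) : α := (A.prog ω).result O

/-- The (random) number of oracle calls against the oracle `O`. -/
def RandAlg.calls (A : RandAlg Q R α) (O : Q → R) (ω : A.Ω) : ℕ := (A.prog ω).calls O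

variable {d n : ℕ}

/-- Stochastic gradient oracle: the query `(i, y)` is answered by `∇fᵢ(y)`. -/
def gradOracle (F : Fin n → E d → ℝ) (q : Fin n × E d) : E d :=
  gradient (F q.1) q.2

/-- Stochastic Hessian-vector product oracle: the query `(i, y, u)` is answered by `∇²fᵢ(y) u`. -/
def hvpOracle (F : Fin n → E d → ℝ) (q : Fin n × E d × E d) : E d :=
  hess (F q.1) q.2.1 q.2.2

end Oracle

section Algorithm

variable {d : ℕ} {Q R : Type}

/-- The law of a Rademacher random variable, `±1` with probability `1/2` each. -/
def rademacher : Measure ℝ :=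
  (2 : ENNReal)⁻¹ • (Measure.dirac (1 : ℝ) + Measure.dirac (-1 : ℝ))

instance : IsProbabilityMeasure rademacher := by
  constructor
  simp only [rademacher, Measure.smul_apply, Measure.add_apply, measure_univ, smul_eq_mul]
  rw [one_add_one_eq_two]
  exact ENNReal.inv_mul_cancel (by simp) (by simp)

/-- The specification of the subroutine ApproxNC at the point `x`, with accuracy `ε` and failure
probability `δ` (the output `none` stands for `⊥`): the output is a random element of
`ℝ^d ∪ {⊥}`, it is a unit vector unless it is `⊥`, and with probability at least `1 - δ` it is
either `⊥`, and then `λ_min(∇²f(x)) ≥ -ε`, or a vector `v` with `vᵀ ∇²f(x) v ≤ -ε/2`. -/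
structure IsApproxNC (A : RandAlg Q R (Option (E d))) (O : Q → R) (f : E d → ℝ) (x : E d)
    (ε δ : ℝ) : Prop where
  /-- measurability for the disjoint-union σ-algebra on `ℝ^d ∪ {⊥}` -/
  measurable : Measurable[A.mΩ, MeasurableSpace.map some (borel (E d))] (A.output O)
  unit : ∀ ω v, A.output O ω = some v → ‖v‖ = 1
  success : 1 - δ ≤ A.P.real {ω | (A.output O ω = none ∧ -ε ≤ lambdaMin (hess f x)) ∨
    ∃ v, A.output O ω = some v ∧ inner ℝ v (hess f x v) ≤ -ε / 2}

/-- Negative curvature descent with third-order smoothness: run the subroutine `A` (ApproxNC at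
`x`); if it returns a vector `v`, draw a Rademacher `ζ` and return `x + ζ η v` with
`η = √(3ε/L₃)`; if it returns `⊥`, return `⊥`. The seed is the seed of `A` together with an
independent `ζ`. -/
def ncd3 (L₃ ε : ℝ) (x : E d) (A : RandAlg Q R (Option (E d))) : RandAlg Q R (Option (E d)) where
  Ω := A.Ω × ℝ
  mΩ := inferInstance
  P := A.P.prod rademacher
  prob := inferInstance
  prog s := (A.prog s.1).bind fun
    | some v => .ret (some (x + (s.2 * √(3 * ε / L₃)) • v))
    | none => .ret none

/-- With probability at least `1 - δ` over the seed of the subroutine, `ncd3` returns a point `ŷ`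
such that the expectation of `f(x) - f(ŷ)` over the Rademacher variable `ζ` alone is at least
`3ε²/(8L₃)`. -/
def DecreasesWithProb (A : RandAlg Q R (Option (E d))) (O : Q → R) (f : E d → ℝ) (x : E d)
    (L₃ ε δ : ℝ) : Prop :=
  1 - δ ≤ A.P.real {ω | (∀ ζ : ℝ, (ncd3 L₃ ε x A).output O (ω, ζ) ≠ none) ∧
    3 * ε ^ 2 / (8 * L₃) ≤
      ∫ ζ, (f x - f (((ncd3 L₃ ε x A).output O (ω, ζ)).getD x)) ∂rademacher}

/-- The expectation of `f(ŷ) - f(x)` over all randomness of `ncd3` exists and is at most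
`-ε²/(8L₃)`. The iterate stays at `x` if the output is `⊥`. -/
def DecreasesInExpectation (A : RandAlg Q R (Option (E d))) (O : Q → R) (f : E d → ℝ) (x : E d)
    (L₃ ε : ℝ) : Prop :=
  Integrable (fun s => f (((ncd3 L₃ ε x A).output O s).getD x) - f x) (ncd3 L₃ ε x A).P ∧
    ∫ s, (f (((ncd3 L₃ ε x A).output O s).getD x) - f x) ∂(ncd3 L₃ ε x A).P
      ≤ -(ε ^ 2 / (8 * L₃))

/-- `C (n + n^{3/4} √(L₁/ε)) log^k(2 + n d L₁ / (ε δ))`: the complexity bound with the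
polylogarithmic factor written out. -/
def complexityBound (C : ℝ) (k d n : ℕ) (L₁ ε δ : ℝ) : ℝ :=
  C * ((n : ℝ) + (n : ℝ) ^ (3 / 4 : ℝ) * √(L₁ / ε)) *
    Real.log (2 + (n : ℝ) * (d : ℝ) * L₁ / (ε * δ)) ^ k

end Algorithm

end NCD3

end

/-!
Let `H` be the Hessian of `f` at `x`, `ε` the accuracy and `δ` the failure probability.

*Decrease.* For a fixed unit vector `v`, the average over the sign `ζ` of `f (x + ζ η v)` cancels the
first and third order terms of the Taylor expansion, so that the average decrease is at least
`-(η² / 2) vᵀHv - (L₃ / 24) η⁴`. With `vᵀHv ≤ -ε / 2` and `η² = 3 ε / L₃` this is at least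
`3 ε² / (8 L₃)`. When the subroutine fails, the function may increase, but on average by no more than
`η² L₁ / 2`, and the condition on `δ` makes this loss harmless.

*Finding negative curvature.* Both implementations of the subroutine are instances of one algorithm,
which only uses products `∇²fᵢ(x) u` with a relative error `τ`. With the Hessian-vector oracle
`τ = 0`; with the gradient oracle the products are difference quotients of `∇fᵢ`, whose error is as
small as desired because the Hessian is Lipschitz and the oracle is exact.
The algorithm tries the scales `s = ε, 2ε, 4ε, …` up to `L₁`. If `-2s ≤ λ_min(H) ≤ -s`, put
`γ = max s (L₁ / √n)` and `M = (5s/4 + γ) (H + 2s + γ)⁻¹`. The eigenvalues of `H` above `-3s/4`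
correspond to eigenvalues of `M` in `[0, 1]`, and those below `-s` to eigenvalues larger than
`1 + s / (8γ)`. The Chebyshev polynomial of the second kind and of degree `O(√(γ/s) log D)` is small on
the former and larger than a power of the problem size `D` on the latter. Applied to a random start
vector, it gives a vector whose Rayleigh quotient is at most `-3s/5` (`inner_apply_chebyshev_le`),
provided that the component of the start vector along the bottom eigenvector is not too small, which
fails with small probability for a uniformly random point of a grid (`expect_gridVec_fail_le`).

The three-term recurrence needs products with `M` only approximately
(`norm_iter_chebStep_sub_le`). Each of them is a linear system with `H + 2s + γ ≥ γ`, which is solved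
by SVRG. The components are not convex, but the method still contracts after
`O((L₁/γ)²) = O(n)` stochastic steps per epoch (`expect_norm_svrg_le`), so that a product costs
`O(n log D)` oracle calls. One scale thus costs `O(n √(γ/s) log² D)` calls, and
`n √(γ/s) ≤ n + n^(3/4) √(L₁/ε)`. Finally the Rayleigh quotient of the candidate is computed with `n`
more products, so that a vector is returned only if it is a direction of negative curvature; hence
only the scale with `s ≤ -λ_min(H) ≤ 2s` has to succeed.

The search is run with failure probability `min δ (ε / (3ε + 8L₁))`, at the price of a larger constant
in the logarithm. Therefore the expected decrease holds for every `δ`.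
-/

noncomputable section

namespace NCD3

open Finset
open scoped BigOperators

/-! ### Random iterations -/

section Iteration

variable {S ι : Type*}

/-- The state reached from `s` after `N` steps of the update rule `f`, the `k`-th of which consumes
the random input `ω k`. -/
def iter (f : S → ι → S) : (N : ℕ) → (Fin N → ι) → S → S
  | 0, _, s => s
  | N + 1, ω, s => iter f N (fun k => ω k.succ) (f s (ω 0))

/-- Along the run of `iter f N ω s`, every input satisfies `good` at the state that meets it. -/
def GoodRun (f : S → ι → S) (good : S → ι → Prop) : (N : ℕ) → (Fin N → ι) → S → Prop
  | 0, _, _ => True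
  | N + 1, ω, s => good s (ω 0) ∧ GoodRun f good N (fun k => ω k.succ) (f s (ω 0))

theorem expect_pi_succ [Fintype ι] {N : ℕ} (F : (Fin (N + 1) → ι) → ℝ) :
    𝔼 ω, F ω = 𝔼 i, 𝔼 ω : Fin N → ι, F (Fin.cons i ω) := by
  rw [← Finset.expect_product', Finset.univ_product_univ]
  exact (Fintype.expect_equiv (Fin.consEquiv fun _ => ι) _ _ fun _ => rfl).symm

theorem expect_iter_le [Fintype ι] [Nonempty ι] {f : S → ι → S} {Φ : S → ℝ} {ρ c : ℝ} (hρ : 0 ≤ ρ)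
    (h : ∀ s, 𝔼 i, Φ (f s i) ≤ ρ * Φ s + (1 - ρ) * c) (N : ℕ) (s : S) :
    𝔼 ω : Fin N → ι, Φ (iter f N ω s) ≤ ρ ^ N * Φ s + (1 - ρ ^ N) * c := by
  induction N generalizing s with
  | zero => simp [iter]
  | succ N ih =>
    rw [expect_pi_succ]
    calc 𝔼 i, 𝔼 ω : Fin N → ι, Φ (iter f (N + 1) (Fin.cons i ω) s)
        ≤ 𝔼 i, (ρ ^ N * Φ (f s i) + (1 - ρ ^ N) * c) := by
          refine Finset.expect_le_expect fun i _ => ?_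
          simpa [iter] using ih (f s i)
      _ = ρ ^ N * (𝔼 i, Φ (f s i)) + (1 - ρ ^ N) * c := by
          rw [Finset.expect_add_distrib, ← Finset.mul_expect, Fintype.expect_const]
      _ ≤ ρ ^ N * (ρ * Φ s + (1 - ρ) * c) + (1 - ρ ^ N) * c := by
          gcongr
          exact h s
      _ = _ := by ring

open scoped Classical in
theorem expect_not_goodRun_le [Fintype ι] [Nonempty ι] {f : S → ι → S} {good : S → ι → Prop}
    {p : ℝ} (h : ∀ s, 𝔼 i, (if good s i then (0 : ℝ) else 1) ≤ p) (N : ℕ) (s : S) :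
    𝔼 ω : Fin N → ι, (if GoodRun f good N ω s then (0 : ℝ) else 1) ≤ N * p := by
  induction N generalizing s with
  | zero => simp [GoodRun]
  | succ N ih =>
    rw [expect_pi_succ]
    calc 𝔼 i, 𝔼 ω : Fin N → ι, (if GoodRun f good (N + 1) (Fin.cons i ω) s then (0 : ℝ) else 1)
        ≤ 𝔼 i, 𝔼 ω : Fin N → ι, ((if good s i then (0 : ℝ) else 1) +
            (if GoodRun f good N ω (f s i) then (0 : ℝ) else 1)) := by
          refine Finset.expect_le_expect fun i _ => Finset.expect_le_expect fun ω _ => ?_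
          simp only [GoodRun, Fin.cons_zero, Fin.cons_succ]
          split_ifs <;> simp_all
      _ = 𝔼 i, ((if good s i then (0 : ℝ) else 1) +
            𝔼 ω : Fin N → ι, (if GoodRun f good N ω (f s i) then (0 : ℝ) else 1)) := by
          refine Finset.expect_congr rfl fun i _ => ?_
          rw [Finset.expect_add_distrib, Fintype.expect_const]
      _ ≤ 𝔼 i, ((if good s i then (0 : ℝ) else 1) + N * p) :=
          Finset.expect_le_expect fun i _ => by gcongr; exact ih _
      _ = (𝔼 i, (if good s i then (0 : ℝ) else 1)) + N * p := by
          rw [Finset.expect_add_distrib, Fintype.expect_const]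
      _ ≤ p + N * p := by gcongr; exact h s
      _ = _ := by push_cast; ring

theorem GoodRun.invariant {f : S → ι → S} {good : S → ι → Prop} {Inv : ℕ → S → Prop} {N : ℕ}
    {ω : Fin N → ι} {s : S} {k : ℕ} (h : GoodRun f good N ω s) (h0 : Inv k s)
    (hstep : ∀ l s i, l < k + N → Inv l s → good s i → Inv (l + 1) (f s i)) :
    Inv (k + N) (iter f N ω s) := by
  induction N generalizing s k with
  | zero => exact h0
  | succ N ih =>
    have := ih (k := k + 1) h.2 (hstep k s _ (by omega) h0 h.1)
      (fun l s i hl => hstep l s i (by omega))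
    rwa [show k + 1 + N = k + (N + 1) by omega] at this

theorem iter_add {V : Type*} [AddCommMonoid V] (h : ι → V) {N : ℕ} (ω : Fin N → ι) (v : V) :
    iter (fun s i => s + h i) N ω v = v + ∑ k, h (ω k) := by
  induction N generalizing v with
  | zero => simp [iter]
  | succ N ih => rw [iter, ih, Fin.sum_univ_succ, add_assoc]

open scoped Classical in
/-- Markov's inequality for the uniform distribution on a finite set. -/
theorem expect_ite_le_of_expect_le [Fintype ι] {Φ : ι → ℝ} {t p : ℝ} (ht : 0 ≤ t) (hp : 0 ≤ p)
    (hΦ : ∀ i, 0 ≤ Φ i) (h : 𝔼 i, Φ i ≤ p * t) :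
    𝔼 i, (if Φ i ≤ t then (0 : ℝ) else 1) ≤ p := by
  rcases ht.eq_or_lt with rfl | ht
  · have h0 : 𝔼 i, Φ i = 0 :=
      le_antisymm (by simpa using h) (Finset.expect_nonneg fun i _ => hΦ i)
    have h1 := (Finset.expect_eq_zero_iff_of_nonneg fun i _ => hΦ i).1 h0
    rw [Finset.expect_eq_zero fun i hi => by simp [h1 i hi]]
    exact hp
  have : (𝔼 i, (if Φ i ≤ t then (0 : ℝ) else 1)) * t ≤ p * t := by
    refine le_trans ?_ h
    rw [Finset.expect_mul]
    refine Finset.expect_le_expect fun i _ => ?_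
    split_ifs with hi
    · simpa using hΦ i
    · linarith
  exact le_of_mul_le_mul_right this ht

end Iteration

/-! ### Growth of the Chebyshev polynomials -/

section Chebyshev

open Polynomial Polynomial.Chebyshev

theorem abs_eval_T_le_exp {x φ : ℝ} (hφ : 0 ≤ φ) (hx0 : 0 ≤ x) (hx : x ≤ Real.cosh φ) (k : ℕ) :
    |(T ℝ (k : ℤ)).eval x| ≤ Real.exp (k * φ) := by
  rcases le_total x 1 with h1 | h1
  · refine (abs_eval_T_real_le_one _ (abs_le.2 ⟨by linarith, h1⟩)).trans ?_
    exact Real.one_le_exp (by positivity)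
  · rw [← Real.cosh_arcosh h1, T_real_cosh, abs_of_pos (Real.cosh_pos _)]
    have h0 : 0 ≤ Real.arcosh x := Real.arcosh_nonneg h1
    have hle : Real.arcosh x ≤ φ := by
      have := Real.cosh_le_cosh.1 ((Real.cosh_arcosh h1).le.trans hx)
      rwa [abs_of_nonneg h0, abs_of_nonneg hφ] at this
    have hk : (0 : ℝ) ≤ k * Real.arcosh x := by positivity
    have : Real.cosh ((k : ℤ) * Real.arcosh x) ≤ Real.exp (k * Real.arcosh x) := by
      push_cast
      rw [Real.cosh_eq]
      have : Real.exp (-(k * Real.arcosh x)) ≤ Real.exp (k * Real.arcosh x) :=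
        Real.exp_le_exp.2 (by linarith)
      linarith
    refine this.trans (Real.exp_le_exp.2 ?_)
    gcongr

theorem abs_eval_U_le_exp {x φ : ℝ} (hφ : 0 ≤ φ) (hx0 : 0 ≤ x) (hx : x ≤ Real.cosh φ) (k : ℕ) :
    |(U ℝ (k : ℤ)).eval x| ≤ (k + 1) * Real.exp (k * φ) := by
  induction k with
  | zero => simp
  | succ k ih =>
    have hxe : x ≤ Real.exp φ := by
      refine hx.trans ?_
      rw [Real.cosh_eq]
      have : Real.exp (-φ) ≤ Real.exp φ := Real.exp_le_exp.2 (by linarith)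
      linarith
    have hT := abs_eval_T_le_exp hφ hx0 hx (k + 1)
    push_cast at hT ⊢
    rw [U_eq_X_mul_U_add_T]
    simp only [eval_add, eval_mul, eval_X]
    refine (abs_add_le _ _).trans ?_
    rw [abs_mul, abs_of_nonneg hx0]
    have h2 : x * |(U ℝ (k : ℤ)).eval x| ≤ Real.exp φ * ((k + 1) * Real.exp (k * φ)) := by
      gcongr
    have h3 : Real.exp φ * ((k + 1) * Real.exp (k * φ)) = (k + 1) * Real.exp ((k + 1) * φ) := by
      rw [show ((k : ℝ) + 1) * φ = φ + k * φ by ring, Real.exp_add]; ring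
    linarith

theorem abs_eval_U_le {x : ℝ} (hx0 : 0 ≤ x) (hx : x ≤ 1) (k : ℕ) :
    |(U ℝ (k : ℤ)).eval x| ≤ k + 1 := by
  simpa using abs_eval_U_le_exp le_rfl hx0 (by simpa using hx) k

theorem exp_le_eval_U {x φ : ℝ} (hφ : 0 ≤ φ) (hx : Real.cosh φ ≤ x) (k : ℕ) :
    Real.exp (k * φ) / 2 ≤ (U ℝ (k : ℤ)).eval x := by
  have h1 : 1 ≤ x := (Real.one_le_cosh φ).trans hx
  have hT : ∀ k : ℕ, Real.exp (k * φ) / 2 ≤ (T ℝ (k : ℤ)).eval x := fun k => by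
    rw [← Real.cosh_arcosh h1, T_real_cosh, Real.cosh_eq]
    have h0 : 0 ≤ Real.arcosh x := Real.arcosh_nonneg h1
    have hle : φ ≤ Real.arcosh x := by
      have := Real.cosh_le_cosh.1 (hx.trans (Real.cosh_arcosh h1).ge)
      rwa [abs_of_nonneg h0, abs_of_nonneg hφ] at this
    have : Real.exp (k * φ) ≤ Real.exp ((k : ℤ) * Real.arcosh x) := by
      push_cast
      exact Real.exp_le_exp.2 (by gcongr)
    have := Real.exp_pos (-((k : ℤ) * Real.arcosh x))
    linarith
  have hU : ∀ k : ℕ, (T ℝ (k : ℤ)).eval x ≤ (U ℝ (k : ℤ)).eval x ∧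
      0 ≤ (U ℝ (k : ℤ)).eval x := by
    intro k
    induction k with
    | zero => simp
    | succ k ih =>
      have h := hT (k + 1)
      have hp := Real.exp_pos ((k + 1 : ℕ) * φ)
      push_cast at h hp ⊢
      rw [U_eq_X_mul_U_add_T]
      simp only [eval_add, eval_mul, eval_X]
      have : 0 ≤ x * (U ℝ (k : ℤ)).eval x := mul_nonneg (by linarith) ih.2
      constructor <;> linarith
  exact (hT k).trans (hU k).1

theorem one_add_le_cosh_two_mul_sqrt {q : ℝ} (hq : 0 ≤ q) :
    1 + 5 / 4 * q ≤ Real.cosh (2 * √q) := by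
  have h : √q ≤ Real.sinh √q := Real.self_le_sinh_iff.2 (Real.sqrt_nonneg q)
  have h2 : q ≤ Real.sinh √q ^ 2 := by
    calc q = √q ^ 2 := (Real.sq_sqrt hq).symm
      _ ≤ _ := by gcongr
  rw [Real.cosh_two_mul, Real.cosh_sq]
  linarith

theorem cosh_sqrt_div_four_le {q : ℝ} (hq : 0 ≤ q) (hq1 : q ≤ 1) :
    Real.cosh (√q / 4) ≤ 1 + q / 8 := by
  refine (Real.cosh_le_exp_half_sq _).trans ?_
  have : (√q / 4) ^ 2 / 2 = q / 32 := by rw [div_pow, Real.sq_sqrt hq]; ring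
  rw [this]
  have h := Real.abs_exp_sub_one_le (x := q / 32) (by rw [abs_of_nonneg (by positivity)]; linarith)
  rw [abs_of_nonneg (a := q / 32) (by positivity)] at h
  have := (abs_le.1 h).2
  linarith

end Chebyshev

/-! ### The Chebyshev iteration with inexact products -/

section Diagonal

variable {V ι : Type*} [NormedAddCommGroup V] [InnerProductSpace ℝ V] [Fintype ι]

/-- The operator that is diagonal in the orthonormal basis `b`, with diagonal entries `c`. -/
def diagOp (b : OrthonormalBasis ι ℝ V) (c : ι → ℝ) : V →ₗ[ℝ] V where
  toFun y := ∑ i, (c i * inner ℝ (b i) y) • b i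
  map_add' y z := by simp [inner_add_right, mul_add, add_smul, Finset.sum_add_distrib]
  map_smul' r y := by
    simp only [inner_smul_right, Finset.smul_sum, smul_smul, RingHom.id_apply]
    exact Finset.sum_congr rfl fun i _ => by ring_nf

variable (b : OrthonormalBasis ι ℝ V)

theorem ext_inner_basis {y z : V} (h : ∀ i, inner ℝ (b i) y = inner ℝ (b i) z) : y = z := by
  apply b.repr.injective
  ext i
  simpa [b.repr_apply_apply] using h i

theorem norm_sq_eq_sum_inner (y : V) : ‖y‖ ^ 2 = ∑ i, inner ℝ (b i) y ^ 2 := by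
  rw [← b.sum_sq_norm_inner_right y]
  simp

@[simp]
theorem inner_diagOp (c : ι → ℝ) (y : V) (i : ι) :
    inner ℝ (b i) (diagOp b c y) = c i * inner ℝ (b i) y := by
  classical
  have : ∀ j, inner ℝ (b i) (b j) = if i = j then (1 : ℝ) else 0 :=
    fun j => orthonormal_iff_ite.1 b.orthonormal i j
  simp [diagOp, inner_sum, inner_smul_right, this]

theorem norm_diagOp_le {c : ι → ℝ} {C : ℝ} (hC : 0 ≤ C) (h : ∀ i, |c i| ≤ C) (y : V) :
    ‖diagOp b c y‖ ≤ C * ‖y‖ := by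
  refine le_of_sq_le_sq ?_ (by positivity)
  rw [mul_pow, norm_sq_eq_sum_inner b, norm_sq_eq_sum_inner b, Finset.mul_sum]
  refine Finset.sum_le_sum fun i _ => ?_
  rw [inner_diagOp, mul_pow]
  gcongr ?_ * _
  exact sq_le_sq' (abs_le.1 (h i)).1 (abs_le.1 (h i)).2

/-- `Uₖ(M)` for `M` diagonal with entries `x`, where `Uₖ` is the Chebyshev polynomial of the second
kind. -/
def chebOp (x : ι → ℝ) (k : ℤ) : V →ₗ[ℝ] V :=
  diagOp b fun i => (Polynomial.Chebyshev.U ℝ k).eval (x i)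

theorem chebOp_add_two (x : ι → ℝ) (k : ℤ) (y : V) :
    chebOp b x (k + 2) y = (2 : ℝ) • diagOp b x (chebOp b x (k + 1) y) - chebOp b x k y := by
  refine ext_inner_basis b fun i => ?_
  simp only [chebOp, inner_sub_right, inner_smul_right, inner_diagOp,
    Polynomial.Chebyshev.U_add_two]
  simp
  ring

@[simp]
theorem chebOp_zero (x : ι → ℝ) (y : V) : chebOp b x 0 y = y :=
  ext_inner_basis b fun i => by simp [chebOp]

@[simp]
theorem chebOp_neg_one (x : ι → ℝ) (y : V) : chebOp b x (-1) y = 0 :=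
  ext_inner_basis b fun i => by simp [chebOp]

/-- One step `(y', y) ↦ (y, 2My - y')` of the Chebyshev recurrence, where `P · i` is a randomized
substitute for the operator `M`. -/
def chebStep {J : Type*} (P : V → J → V) (s : V × V) (i : J) : V × V :=
  (s.2, (2 : ℝ) • P s.2 i - s.1)

/-- The `k`-th error enters the iterate multiplied by `U_{m-1-k}(M)`, so that the Chebyshev iteration
amplifies the relative error `ξ` of a product by at most `4mB²`, where `B` bounds
`U₀, …, U_m` on the spectrum of `M`. -/
theorem norm_iter_chebStep_sub_le {J : Type*} {P : V → J → V} {x : ι → ℝ} {B ξ : ℝ} {m : ℕ}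
    (hB : 1 ≤ B) (hξ : 0 ≤ ξ) (hU : ∀ k : ℕ, k ≤ m → ∀ i,
      |(Polynomial.Chebyshev.U ℝ (k : ℤ)).eval (x i)| ≤ B)
    (hmB : 4 * ξ * m * B ^ 2 ≤ 1) {ω : Fin m → J} {w : V}
    (hgood : GoodRun (chebStep P) (fun s i => ‖P s.2 i - diagOp b x s.2‖ ≤ ξ * ‖s.2‖) m ω (0, w)) :
    ‖(iter (chebStep P) m ω (0, w)).2 - chebOp b x m w‖ ≤ ‖w‖ := by
  set ζ := 4 * ξ * B * ‖w‖ with hζ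
  have hζ0 : 0 ≤ ζ := by positivity
  have hop : ∀ k : ℕ, k ≤ m → ∀ y : V, ‖chebOp b x k y‖ ≤ B * ‖y‖ := fun k hk y =>
    norm_diagOp_le b (by linarith) (hU k hk) y
  have hsum : ∀ (k : ℕ) (e : ℕ → V), k ≤ m → (∀ j, j < k → ‖e j‖ ≤ ζ) →
      ‖∑ j ∈ range k, chebOp b x (k - 1 - j : ℤ) (e j)‖ ≤ ‖w‖ := by
    intro k e hk he
    calc ‖∑ j ∈ range k, chebOp b x (k - 1 - j : ℤ) (e j)‖
        ≤ ∑ j ∈ range k, B * ζ := by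
          refine norm_sum_le_of_le _ fun j hj => ?_
          have hj := Finset.mem_range.1 hj
          have hc : (k - 1 - j : ℤ) = ((k - 1 - j : ℕ) : ℤ) := by omega
          rw [hc]
          refine (hop _ (by omega) _).trans ?_
          gcongr
          exact he j hj
      _ = k * (B * ζ) := by simp
      _ ≤ m * (B * ζ) := by gcongr
      _ = (4 * ξ * m * B ^ 2) * ‖w‖ := by rw [hζ]; ring
      _ ≤ 1 * ‖w‖ := by gcongr
      _ = ‖w‖ := one_mul _
  let Inv : ℕ → V × V → Prop := fun k s => ∃ e : ℕ → V, (∀ j, j < k → ‖e j‖ ≤ ζ) ∧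
    s.2 = chebOp b x k w + ∑ j ∈ range k, chebOp b x (k - 1 - j : ℤ) (e j) ∧
    s.1 = chebOp b x (k - 1 : ℤ) w + ∑ j ∈ range k, chebOp b x (k - 2 - j : ℤ) (e j)
  have key : Inv (0 + m) (iter (chebStep P) m ω (0, w)) := by
    refine hgood.invariant (Inv := Inv) ⟨fun _ => 0, by simp, by simp, by simp⟩ ?_
    rintro k ⟨y', y⟩ i hk ⟨e, he, hy, hy'⟩ hg
    simp only at hy hy' hg
    have hym : ‖y‖ ≤ 2 * B * ‖w‖ := by
      rw [hy]
      refine (norm_add_le _ _).trans ?_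
      have h1 := hop k (by omega) w
      have h2 := hsum k e (by omega) he
      nlinarith [norm_nonneg w]
    refine ⟨fun j => if j < k then e j else (2 : ℝ) • (P y i - diagOp b x y), ?_, ?_, ?_⟩
    · intro j hj
      by_cases hjk : j < k
      · simpa [hjk] using he j hjk
      · simp only [hjk, if_false, norm_smul, Real.norm_ofNat]
        have : ξ * ‖y‖ ≤ ξ * (2 * B * ‖w‖) := by gcongr
        rw [hζ]; linarith
    · rw [Finset.sum_range_succ]
      have h1 : ∑ j ∈ range k, chebOp b x (((k + 1 : ℕ) : ℤ) - 1 - j)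
          (if j < k then e j else (2 : ℝ) • (P y i - diagOp b x y)) =
          ∑ j ∈ range k, chebOp b x ((k - 2 - j : ℤ) + 2) (e j) := by
        refine Finset.sum_congr rfl fun j hj => ?_
        rw [if_pos (Finset.mem_range.1 hj)]
        congr 2
        push_cast; ring
      have h2 : chebOp b x ((k + 1 : ℕ) : ℤ) w = chebOp b x ((k - 1 : ℤ) + 2) w := by
        congr 2; push_cast; ring
      rw [h1, h2, chebOp_add_two]
      simp only [chebOp_add_two, chebStep, lt_irrefl, if_false]
      have h3 : ((k + 1 : ℕ) : ℤ) - 1 - k = 0 := by push_cast; ring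
      rw [h3, chebOp_zero, Finset.sum_sub_distrib, ← Finset.smul_sum, ← map_sum]
      have h4 : ∑ j ∈ range k, chebOp b x ((k - 2 - j : ℤ) + 1) (e j) =
          ∑ j ∈ range k, chebOp b x (k - 1 - j : ℤ) (e j) :=
        Finset.sum_congr rfl fun j _ => by congr 2; ring
      have h5 : (k - 1 : ℤ) + 1 = k := by ring
      rw [h4, h5, hy']
      have h6 : diagOp b x y = diagOp b x (chebOp b x k w) +
          diagOp b x (∑ j ∈ range k, chebOp b x (k - 1 - j : ℤ) (e j)) := by rw [hy, map_add]
      rw [h6]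
      simp only [smul_sub, smul_add]
      abel
    · rw [Finset.sum_range_succ]
      have h3 : ((k + 1 : ℕ) : ℤ) - 2 - k = -1 := by push_cast; ring
      rw [h3, chebOp_neg_one, add_zero]
      simp only [chebStep]
      rw [hy]
      congr 1
      · congr 2; push_cast; ring
      · refine Finset.sum_congr rfl fun j hj => ?_
        rw [if_pos (Finset.mem_range.1 hj)]
        congr 2; push_cast; ring
  rw [zero_add] at key
  obtain ⟨e, he, hy, -⟩ := key
  rw [hy, add_sub_cancel_left]
  exact hsum m e le_rfl he

theorem inner_apply_eq_sum {H : V →L[ℝ] V} {lam : ι → ℝ} (hH : ∀ i, H (b i) = lam i • b i) (y : V) :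
    inner ℝ y (H y) = ∑ i, lam i * inner ℝ (b i) y ^ 2 := by
  have h1 : H y = ∑ i, (lam i * inner ℝ (b i) y) • b i := by
    conv_lhs => rw [← b.sum_repr' y]
    simp only [map_sum, map_smul, hH, smul_smul]
    exact Finset.sum_congr rfl fun i _ => by ring_nf
  rw [h1, inner_sum]
  refine Finset.sum_congr rfl fun i _ => ?_
  rw [inner_smul_right, real_inner_comm]
  ring

/-- If a filter `c` amplifies the bottom eigenvector `b i₀` of `H` in the start vector `w`, but stays
below `R` on the eigenvalues above `-3s/4`, then the filtered vector, even when perturbed by `‖w‖`,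
has Rayleigh quotient at most `-3s/5`. -/
theorem inner_apply_le_of_filter {H : V →L[ℝ] V} {lam : ι → ℝ} (hH : ∀ i, H (b i) = lam i • b i)
    {L s R A : ℝ} (hs : 0 < s) (hsL : s ≤ L) (hlamL : ∀ i, lam i ≤ L) {i₀ : ι} (hi₀ : lam i₀ ≤ -s)
    {c : ι → ℝ} (hc : ∀ i, -(3 / 4 * s) < lam i → |c i| ≤ R) {w y : V}
    (hy : ‖y - diagOp b c w‖ ≤ ‖w‖) (hA0 : 0 ≤ A)
    (hA : (1 + A) * ‖w‖ ≤ |c i₀| * |inner ℝ (b i₀) w|)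
    (hAR : 8 * L * (R ^ 2 + 1) ≤ s * A ^ 2) :
    inner ℝ y (H y) ≤ -(3 / 5 * s) * ‖y‖ ^ 2 := by
  classical
  set r := y - diagOp b c w with hr
  have hyi : ∀ i, inner ℝ (b i) y = c i * inner ℝ (b i) w + inner ℝ (b i) r := fun i => by
    rw [hr, inner_sub_right, inner_diagOp]; ring
  have hL : 0 < L := hs.trans_le hsL
  have hy0 : A * ‖w‖ ≤ |inner ℝ (b i₀) y| := by
    have h1 : |inner ℝ (b i₀) r| ≤ ‖w‖ := by
      refine (abs_real_inner_le_norm _ _).trans ?_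
      rw [b.norm_eq_one, one_mul]; exact hy
    have h2 : |c i₀ * inner ℝ (b i₀) w| ≤ |inner ℝ (b i₀) y| + |inner ℝ (b i₀) r| := by
      have := hyi i₀
      rw [show c i₀ * inner ℝ (b i₀) w = inner ℝ (b i₀) y - inner ℝ (b i₀) r by rw [this]; ring]
      exact abs_sub _ _
    rw [abs_mul] at h2
    linarith
  have hterm : ∀ i, (lam i + 3 / 5 * s) * inner ℝ (b i) y ^ 2 ≤
      16 / 5 * L * (R ^ 2 * inner ℝ (b i) w ^ 2 + inner ℝ (b i) r ^ 2) +
        (if i = i₀ then -(2 / 5 * s * inner ℝ (b i) y ^ 2) else 0) := by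
    intro i
    have hnn : 0 ≤ 16 / 5 * L * (R ^ 2 * inner ℝ (b i) w ^ 2 + inner ℝ (b i) r ^ 2) := by
      positivity
    by_cases hi : i = i₀
    · subst hi
      rw [if_pos rfl]
      nlinarith [sq_nonneg (inner ℝ (b i) y)]
    · rw [if_neg hi, add_zero]
      by_cases hb : -(3 / 4 * s) < lam i
      · have h1 : (lam i + 3 / 5 * s) * inner ℝ (b i) y ^ 2 ≤
            8 / 5 * L * inner ℝ (b i) y ^ 2 := by
          gcongr; linarith [hlamL i]
        have h2 : inner ℝ (b i) y ^ 2 ≤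
            2 * (R ^ 2 * inner ℝ (b i) w ^ 2 + inner ℝ (b i) r ^ 2) := by
          have h3 : c i ^ 2 ≤ R ^ 2 := sq_le_sq' (abs_le.1 (hc i hb)).1 (abs_le.1 (hc i hb)).2
          have h4 : c i ^ 2 * inner ℝ (b i) w ^ 2 ≤ R ^ 2 * inner ℝ (b i) w ^ 2 := by gcongr
          rw [hyi i]
          nlinarith [sq_nonneg (c i * inner ℝ (b i) w - inner ℝ (b i) r)]
        have h5 : 8 / 5 * L * inner ℝ (b i) y ^ 2 ≤
            8 / 5 * L * (2 * (R ^ 2 * inner ℝ (b i) w ^ 2 + inner ℝ (b i) r ^ 2)) := by gcongr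
        linarith
      · push Not at hb
        have : (lam i + 3 / 5 * s) * inner ℝ (b i) y ^ 2 ≤ 0 :=
          mul_nonpos_of_nonpos_of_nonneg (by linarith) (sq_nonneg _)
        linarith
  have hsum := Finset.sum_le_sum fun i (_ : i ∈ Finset.univ) => hterm i
  rw [Finset.sum_add_distrib, Finset.sum_ite_eq' Finset.univ i₀, if_pos (Finset.mem_univ _),
    ← Finset.mul_sum, Finset.sum_add_distrib, ← Finset.mul_sum, ← norm_sq_eq_sum_inner b,
    ← norm_sq_eq_sum_inner b] at hsum
  have hlhs : ∑ i, (lam i + 3 / 5 * s) * inner ℝ (b i) y ^ 2 =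
      inner ℝ y (H y) + 3 / 5 * s * ‖y‖ ^ 2 := by
    rw [inner_apply_eq_sum b hH, norm_sq_eq_sum_inner b y, Finset.mul_sum,
      ← Finset.sum_add_distrib]
    exact Finset.sum_congr rfl fun i _ => by ring
  rw [hlhs] at hsum
  have hr2 : ‖r‖ ^ 2 ≤ ‖w‖ ^ 2 := by gcongr
  have hy2 : A ^ 2 * ‖w‖ ^ 2 ≤ inner ℝ (b i₀) y ^ 2 := by
    rw [← mul_pow, ← sq_abs (inner ℝ (b i₀) y)]
    gcongr
  have e1 : 16 / 5 * L * (R ^ 2 * ‖w‖ ^ 2 + ‖r‖ ^ 2) ≤ 16 / 5 * L * (R ^ 2 * ‖w‖ ^ 2 + ‖w‖ ^ 2) := by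
    gcongr
  have e2 : s * (A ^ 2 * ‖w‖ ^ 2) ≤ s * inner ℝ (b i₀) y ^ 2 := by gcongr
  have e3 : 8 * L * (R ^ 2 + 1) * ‖w‖ ^ 2 ≤ s * A ^ 2 * ‖w‖ ^ 2 := by gcongr
  nlinarith

end Diagonal

/-! ### Variance-reduced solution of shifted linear systems -/

section SVRG

theorem norm_sub_sq_le_of_pos {V : Type*} [SeminormedAddCommGroup V] (p e : V) {c : ℝ} (hc : 0 < c) :
    ‖p - e‖ ^ 2 ≤ (1 + c) * ‖p‖ ^ 2 + (1 + 1 / c) * ‖e‖ ^ 2 := by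
  have h1 : ‖p - e‖ ^ 2 ≤ (‖p‖ + ‖e‖) ^ 2 := by gcongr; exact norm_sub_le _ _
  have h2 : c * ‖p‖ ^ 2 + 1 / c * ‖e‖ ^ 2 - 2 * ‖p‖ * ‖e‖ = (c * ‖p‖ - ‖e‖) ^ 2 / c := by
    field_simp; ring
  have h3 : 0 ≤ (c * ‖p‖ - ‖e‖) ^ 2 / c := by positivity
  nlinarith

variable {V : Type*} [NormedAddCommGroup V] [InnerProductSpace ℝ V] {n : ℕ}

/-- The average `u ↦ (1/n) ∑ᵢ gᵢ(u)` of `n` maps. -/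
def avgMap (g : Fin n → V → V) (u : V) : V := (n : ℝ)⁻¹ • ∑ i, g i u

/-- One step of SVRG with anchor `a`, at which the full average is `G`, for the linear system
`H x + lam x = r`, `H` being the average of the operators approximated by `g`. -/
def svrgStep (g : Fin n → V → V) (lam η : ℝ) (r a G x : V) (i : Fin n) : V :=
  x - η • (g i (x - a) + G + lam • x - r)

/-- An epoch of SVRG: `T` stochastic steps that start from the anchor. -/
def svrgEpoch (g : Fin n → V → V) (lam η : ℝ) (T : ℕ) (r a : V) (ω : Fin T → Fin n) : V :=
  iter (svrgStep g lam η r a (avgMap g a)) T ω a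

/-- `K` epochs of SVRG, started from `0`. -/
def svrg (g : Fin n → V → V) (lam η : ℝ) (T K : ℕ) (r : V) (ω : Fin K → Fin T → Fin n) : V :=
  iter (svrgEpoch g lam η T r) K ω 0

/-- The operators `A i` are bounded by `L`, `g i` computes `A i` up to the relative error `τ`, and
`H` is the average of the `A i`. -/
structure ApproxFamily (g : Fin n → V → V) (A : Fin n → V →L[ℝ] V) (H : V →L[ℝ] V) (L τ : ℝ) :
    Prop where
  bound : ∀ i u, ‖A i u‖ ≤ L * ‖u‖
  approx : ∀ i u, ‖g i u - A i u‖ ≤ τ * ‖u‖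
  avg : ∀ u, H u = (n : ℝ)⁻¹ • ∑ i, A i u

variable {g : Fin n → V → V} {A : Fin n → V →L[ℝ] V} {H : V →L[ℝ] V} {L τ : ℝ}

theorem norm_inv_smul_sum_le {v : Fin n → V} {C : ℝ} (hC : 0 ≤ C) (h : ∀ i, ‖v i‖ ≤ C) :
    ‖(n : ℝ)⁻¹ • ∑ i, v i‖ ≤ C := by
  rw [norm_smul, norm_inv, Real.norm_natCast]
  have : ‖∑ i, v i‖ ≤ n * C := by
    simpa using norm_sum_le_of_le Finset.univ fun i _ => h i
  rcases Nat.eq_zero_or_pos n with rfl | hn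
  · simpa using hC
  · have hn' : (0 : ℝ) < n := by exact_mod_cast hn
    rw [inv_mul_le_iff₀ hn']; exact this

theorem ApproxFamily.norm_avgMap_sub_le (h : ApproxFamily g A H L τ) (hτ : 0 ≤ τ) (u : V) :
    ‖avgMap g u - H u‖ ≤ τ * ‖u‖ := by
  rw [avgMap, h.avg, ← smul_sub, ← Finset.sum_sub_distrib]
  exact norm_inv_smul_sum_le (by positivity) fun i => h.approx i u

theorem ApproxFamily.norm_apply_le (h : ApproxFamily g A H L τ) (hL : 0 ≤ L) (u : V) :
    ‖H u‖ ≤ L * ‖u‖ := by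
  rw [h.avg]
  exact norm_inv_smul_sum_le (by positivity) fun i => h.bound i u

theorem ApproxFamily.expect_inner (h : ApproxFamily g A H L τ) (z u : V) :
    𝔼 i, inner ℝ z (A i u) = inner ℝ z (H u) := by
  rw [Fintype.expect_eq_sum_div_card, h.avg, inner_smul_right, inner_sum, Fintype.card_fin,
    div_eq_inv_mul]

theorem norm_add_sq_le_two (p e : V) : ‖p + e‖ ^ 2 ≤ 2 * ‖p‖ ^ 2 + 2 * ‖e‖ ^ 2 := by
  have := parallelogram_law_with_norm ℝ p e
  nlinarith [sq_nonneg ‖p - e‖]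

variable {lam γ l σ : ℝ}

set_option maxHeartbeats 1000000 in
/-- The error of a stochastic step, conditionally on the current iterate. The component operators
need not be positive; only their average plus `lam` is. -/
theorem expect_norm_svrgStep_le [NeZero n] (h : ApproxFamily g A H L τ) (hτ : 0 ≤ τ)
    (hlam : 0 ≤ lam) (hL : 0 ≤ L) (hγ : 0 < γ) (hγl : γ ≤ l) (hl : L + lam ≤ l)
    (hcoer : ∀ z, γ * ‖z‖ ^ 2 ≤ inner ℝ z (H z + lam • z)) (hσ : 60 * τ ^ 2 ≤ γ ^ 2 * σ)
    (hσ1 : σ ≤ 1 / 100) {r xs : V} (hxs : H xs + lam • xs = r) (a x : V) :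
    𝔼 i, ‖svrgStep g lam (γ / (16 * l ^ 2)) r a (avgMap g a) x i - xs‖ ^ 2 ≤
      (1 - γ ^ 2 / (16 * l ^ 2)) * ‖x - xs‖ ^ 2 +
        (1 - (1 - γ ^ 2 / (16 * l ^ 2))) * (2 / 5 * ‖a - xs‖ ^ 2 + σ * ‖xs‖ ^ 2) := by
  have hl0 : 0 < l := hγ.trans_le hγl
  set η := γ / (16 * l ^ 2) with hη
  have hη0 : 0 < η := by positivity
  have hα : γ ^ 2 / (16 * l ^ 2) = η * γ := by rw [hη]; ring
  rw [hα]
  set α := η * γ with hαdef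
  have hα0 : 0 < α := by positivity
  have hηl : η ^ 2 * l ^ 2 = α / 16 := by rw [hαdef, hη]; field_simp
  have hα1 : α ≤ 1 / 16 := by
    have : γ ^ 2 ≤ l ^ 2 := by gcongr
    rw [← hα, div_le_iff₀ (by positivity)]
    linarith
  have hσ0 : 0 ≤ σ := by
    have h1 : 0 ≤ γ ^ 2 * σ := le_trans (by positivity) hσ
    exact nonneg_of_mul_nonneg_right h1 (by positivity)
  set z := x - xs with hz
  set y := a - xs with hy
  have hxa : x - a = z - y := by rw [hz, hy]; abel
  have ha : ‖a‖ ≤ ‖y‖ + ‖xs‖ := by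
    calc ‖a‖ = ‖y + xs‖ := by rw [hy]; congr 1; abel
      _ ≤ _ := norm_add_le _ _
  -- the step with exact products, and the error of the products
  set v : Fin n → V := fun i => (A i (z - y) + lam • (z - y)) + (H y + lam • y) with hv
  set e : Fin n → V := fun i => (g i (x - a) - A i (x - a)) + (avgMap g a - H a) with he
  have hstep : ∀ i, svrgStep g lam η r a (avgMap g a) x i - xs = (z - η • v i) - η • e i := by
    intro i
    have h1 : g i (x - a) + avgMap g a + lam • x - r = v i + e i := by
      simp only [hv, he, ← hxs, hxa]
      have h2 : H a = H y + H xs := by rw [hy, map_sub]; abel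
      have h3 : x = z + xs := by rw [hz]; abel
      rw [h2, h3]
      simp only [smul_add, smul_sub]
      abel
    rw [svrgStep, h1, smul_add, hz]
    abel
  have hvn : ∀ i, ‖v i‖ ^ 2 ≤ l ^ 2 * (4 * ‖z‖ ^ 2 + 6 * ‖y‖ ^ 2) := by
    intro i
    have hb : ∀ u : V, ∀ q : V, ‖q‖ ≤ L * ‖u‖ → ‖q + lam • u‖ ≤ l * ‖u‖ := by
      intro u q hq
      refine (norm_add_le _ _).trans ?_
      rw [norm_smul, Real.norm_of_nonneg hlam]
      nlinarith [norm_nonneg u]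
    have h1 := hb _ _ (h.bound i (z - y))
    have h2 := hb _ _ (h.norm_apply_le hL y)
    have h3 : ‖z - y‖ ^ 2 ≤ 2 * ‖z‖ ^ 2 + 2 * ‖y‖ ^ 2 := by
      have := norm_add_sq_le_two z (-y)
      rwa [norm_neg, ← sub_eq_add_neg] at this
    have h4 : ‖A i (z - y) + lam • (z - y)‖ ^ 2 ≤ l ^ 2 * ‖z - y‖ ^ 2 := by
      rw [← mul_pow]; gcongr
    have h5 : ‖H y + lam • y‖ ^ 2 ≤ l ^ 2 * ‖y‖ ^ 2 := by
      rw [← mul_pow]; gcongr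
    have h6 := norm_add_sq_le_two (A i (z - y) + lam • (z - y)) (H y + lam • y)
    have h7 : l ^ 2 * ‖z - y‖ ^ 2 ≤ l ^ 2 * (2 * ‖z‖ ^ 2 + 2 * ‖y‖ ^ 2) := by gcongr
    simp only [hv]
    linarith
  have hen : ∀ i, ‖e i‖ ^ 2 ≤ 3 * τ ^ 2 * (‖z‖ ^ 2 + 4 * ‖y‖ ^ 2 + ‖xs‖ ^ 2) := by
    intro i
    have h1 : ‖e i‖ ≤ τ * (‖z‖ + 2 * ‖y‖ + ‖xs‖) := by
      have h2 := h.approx i (x - a)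
      have h3 := h.norm_avgMap_sub_le hτ a
      have h4 : ‖x - a‖ ≤ ‖z‖ + ‖y‖ := by rw [hxa]; exact norm_sub_le _ _
      have h5 : τ * ‖x - a‖ ≤ τ * (‖z‖ + ‖y‖) := by gcongr
      have h6 : τ * ‖a‖ ≤ τ * (‖y‖ + ‖xs‖) := by gcongr
      refine (norm_add_le _ _).trans ?_
      linarith
    have h2 : ‖e i‖ ^ 2 ≤ (τ * (‖z‖ + 2 * ‖y‖ + ‖xs‖)) ^ 2 := by gcongr
    have h3 : (‖z‖ + 2 * ‖y‖ + ‖xs‖) ^ 2 ≤ 3 * (‖z‖ ^ 2 + 4 * ‖y‖ ^ 2 + ‖xs‖ ^ 2) := by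
      nlinarith [sq_nonneg (‖z‖ - 2 * ‖y‖), sq_nonneg (‖z‖ - ‖xs‖), sq_nonneg (2 * ‖y‖ - ‖xs‖)]
    rw [mul_pow] at h2
    have h4 : τ ^ 2 * (‖z‖ + 2 * ‖y‖ + ‖xs‖) ^ 2 ≤
        τ ^ 2 * (3 * (‖z‖ ^ 2 + 4 * ‖y‖ ^ 2 + ‖xs‖ ^ 2)) := by gcongr
    linarith
  have hmean : 𝔼 i, inner ℝ z (v i) = inner ℝ z (H z + lam • z) := by
    have h1 : ∀ i, inner ℝ z (v i) =
        inner ℝ z (A i (z - y)) + inner ℝ z (lam • (z - y) + (H y + lam • y)) := fun i => by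
      rw [← inner_add_right]; simp only [hv]; congr 1; abel
    simp_rw [h1]
    rw [Finset.expect_add_distrib, h.expect_inner, Fintype.expect_const, ← inner_add_right]
    congr 1
    simp only [map_sub, smul_sub]
    abel
  set Q := (α / 16) * (4 * ‖z‖ ^ 2 + 6 * ‖y‖ ^ 2) with hQ
  set W := α * σ / 4 * (‖z‖ ^ 2 + 4 * ‖y‖ ^ 2 + ‖xs‖ ^ 2) with hW
  have hpt : ∀ i, ‖svrgStep g lam η r a (avgMap g a) x i - xs‖ ^ 2 ≤
      ((1 + α / 4) * (‖z‖ ^ 2 + Q) + W) + -((1 + α / 4) * (2 * η)) * inner ℝ z (v i) := by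
    intro i
    rw [hstep]
    have h1 := norm_sub_sq_le_of_pos (z - η • v i) (η • e i) (c := α / 4) (by positivity)
    have h2 : ‖z - η • v i‖ ^ 2 = ‖z‖ ^ 2 - 2 * η * inner ℝ z (v i) + η ^ 2 * ‖v i‖ ^ 2 := by
      rw [norm_sub_sq_real, inner_smul_right, norm_smul, mul_pow, Real.norm_eq_abs, sq_abs]
      ring
    have h3 : η ^ 2 * ‖v i‖ ^ 2 ≤ Q := by
      calc η ^ 2 * ‖v i‖ ^ 2 ≤ η ^ 2 * (l ^ 2 * (4 * ‖z‖ ^ 2 + 6 * ‖y‖ ^ 2)) := by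
            gcongr; exact hvn i
        _ = (η ^ 2 * l ^ 2) * (4 * ‖z‖ ^ 2 + 6 * ‖y‖ ^ 2) := by ring
        _ = Q := by rw [hηl]
    have h4 : (1 + 1 / (α / 4)) * ‖η • e i‖ ^ 2 ≤ W := by
      have h5 : 1 + 1 / (α / 4) ≤ 5 / α := by
        have : 1 ≤ 1 / α := by rw [le_div_iff₀ hα0]; linarith
        have e1 : 1 / (α / 4) = 4 * (1 / α) := by field_simp
        have e2 : 5 / α = 5 * (1 / α) := by ring
        rw [e1, e2]; linarith
      rw [norm_smul, mul_pow, Real.norm_eq_abs, sq_abs]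
      set N2 := ‖z‖ ^ 2 + 4 * ‖y‖ ^ 2 + ‖xs‖ ^ 2 with hN2
      have hN0 : 0 ≤ N2 := by positivity
      calc (1 + 1 / (α / 4)) * (η ^ 2 * ‖e i‖ ^ 2)
          ≤ 5 / α * (η ^ 2 * (3 * τ ^ 2 * N2)) := by
            gcongr; exact hen i
        _ = (η ^ 2 / (4 * α)) * (60 * τ ^ 2) * N2 := by field_simp; ring
        _ ≤ (η ^ 2 / (4 * α)) * (γ ^ 2 * σ) * N2 := by gcongr
        _ = W := by rw [hW, hαdef]; field_simp
    have h6 : (1 + α / 4) * ‖z - η • v i‖ ^ 2 ≤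
        (1 + α / 4) * (‖z‖ ^ 2 - 2 * η * inner ℝ z (v i) + Q) := by
      rw [h2]; gcongr
    linarith
  have hE := Finset.expect_le_expect fun i (_ : i ∈ Finset.univ) => hpt i
  rw [Finset.expect_add_distrib, ← Finset.mul_expect, hmean, Fintype.expect_const] at hE
  have hc : (1 + α / 4) * (2 * η) * (γ * ‖z‖ ^ 2) ≤
      (1 + α / 4) * (2 * η) * inner ℝ z (H z + lam • z) := by
    gcongr; exact hcoer z
  have hc' : (1 + α / 4) * (2 * η) * (γ * ‖z‖ ^ 2) = (1 + α / 4) * (2 * α) * ‖z‖ ^ 2 := by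
    rw [hαdef]; ring
  refine hE.trans ?_
  have hασ : α * σ ≤ α * (1 / 100) := by gcongr
  have hασ0 : 0 ≤ α * σ := by positivity
  have hαα : α * α ≤ α * (1 / 16) := by gcongr
  have hαα0 : 0 ≤ α * α := by positivity
  have b1 : (1 + α / 4) * (1 + α / 4 - 2 * α) + α * σ / 4 ≤ 1 - α := by
    have e : (1 + α / 4) * (1 + α / 4 - 2 * α) = 1 - 3 / 2 * α - 7 / 16 * (α * α) := by ring
    rw [e]; linarith
  have b2 : (1 + α / 4) * (3 * α / 8) + α * σ ≤ 2 / 5 * α := by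
    have e : (1 + α / 4) * (3 * α / 8) = 3 / 8 * α + 3 / 32 * (α * α) := by ring
    rw [e]; linarith
  have b3 : α * σ / 4 ≤ α * σ := by linarith
  have c1 : ((1 + α / 4) * (1 + α / 4 - 2 * α) + α * σ / 4) * ‖z‖ ^ 2 ≤ (1 - α) * ‖z‖ ^ 2 := by
    gcongr
  have c2 : ((1 + α / 4) * (3 * α / 8) + α * σ) * ‖y‖ ^ 2 ≤ 2 / 5 * α * ‖y‖ ^ 2 := by gcongr
  have c3 : α * σ / 4 * ‖xs‖ ^ 2 ≤ α * σ * ‖xs‖ ^ 2 := by gcongr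
  have e1 : (1 + α / 4) * (‖z‖ ^ 2 + Q) + W - (1 + α / 4) * (2 * α) * ‖z‖ ^ 2 =
      ((1 + α / 4) * (1 + α / 4 - 2 * α) + α * σ / 4) * ‖z‖ ^ 2 +
        ((1 + α / 4) * (3 * α / 8) + α * σ) * ‖y‖ ^ 2 + α * σ / 4 * ‖xs‖ ^ 2 := by
    rw [hQ, hW]; ring
  linarith

theorem expect_norm_svrg_le [NeZero n] (h : ApproxFamily g A H L τ) (hτ : 0 ≤ τ)
    (hlam : 0 ≤ lam) (hL : 0 ≤ L) (hγ : 0 < γ) (hγl : γ ≤ l) (hl : L + lam ≤ l)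
    (hcoer : ∀ z, γ * ‖z‖ ^ 2 ≤ inner ℝ z (H z + lam • z)) (hσ : 60 * τ ^ 2 ≤ γ ^ 2 * σ)
    (hσ1 : σ ≤ 1 / 100) {T : ℕ} (hT : 3 ≤ γ ^ 2 / (16 * l ^ 2) * T)
    {r xs : V} (hxs : H xs + lam • xs = r) (K : ℕ) :
    𝔼 ω, ‖svrg g lam (γ / (16 * l ^ 2)) T K r ω - xs‖ ^ 2 ≤
      ((1 / 2) ^ K + 2 * σ) * ‖xs‖ ^ 2 := by
  have hl0 : 0 < l := hγ.trans_le hγl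
  have hσ0 : 0 ≤ σ := by
    have h1 : 0 ≤ γ ^ 2 * σ := le_trans (by positivity) hσ
    exact nonneg_of_mul_nonneg_right h1 (by positivity)
  set α := γ ^ 2 / (16 * l ^ 2) with hα
  have hα0 : 0 < α := by positivity
  have hα1 : α ≤ 1 := by
    have : γ ^ 2 ≤ l ^ 2 := by gcongr
    rw [hα, div_le_iff₀ (by positivity)]
    nlinarith
  have hpow : (1 - α) ^ T ≤ 1 / 10 := by
    have h1 : (1 - α) ^ T ≤ Real.exp (-α) ^ T := by
      refine pow_le_pow_left₀ (by linarith) ?_ T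
      linarith [Real.add_one_le_exp (-α)]
    rw [← Real.exp_nat_mul] at h1
    have h2 : Real.exp (T * -α) ≤ Real.exp (-3) := Real.exp_le_exp.2 (by linarith)
    have h3 : Real.exp (-3) ≤ 1 / 10 := by
      rw [show (-3 : ℝ) = -1 + -1 + -1 by norm_num, Real.exp_add, Real.exp_add]
      have h4 : Real.exp (-1) ≤ 0.3678794412 + 1e-9 := Real.exp_neg_one_lt_d9.le.trans (by norm_num)
      have h5 := Real.exp_pos (-1)
      have h6 : Real.exp (-1) ≤ 2 / 5 := h4.trans (by norm_num)
      nlinarith [mul_le_mul h6 h6 h5.le (by norm_num)]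
    linarith
  have hpow0 : 0 ≤ (1 - α) ^ T := pow_nonneg (by linarith) T
  have hepoch : ∀ a, 𝔼 ω, ‖svrgEpoch g lam (γ / (16 * l ^ 2)) T r a ω - xs‖ ^ 2 ≤
      1 / 2 * ‖a - xs‖ ^ 2 + (1 - 1 / 2) * (2 * σ * ‖xs‖ ^ 2) := by
    intro a
    have h1 := expect_iter_le (Φ := fun x => ‖x - xs‖ ^ 2) (ρ := 1 - α) (by linarith)
      (fun x => expect_norm_svrgStep_le h hτ hlam hL hγ hγl hl hcoer hσ hσ1 hxs a x) T a
    refine h1.trans ?_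
    have h2 : (1 - α) ^ T * ‖a - xs‖ ^ 2 ≤ 1 / 10 * ‖a - xs‖ ^ 2 := by gcongr
    have h3 : (1 - (1 - α) ^ T) * (2 / 5 * ‖a - xs‖ ^ 2 + σ * ‖xs‖ ^ 2) ≤
        1 * (2 / 5 * ‖a - xs‖ ^ 2 + σ * ‖xs‖ ^ 2) := by
      gcongr; linarith
    linarith
  have h1 := expect_iter_le (Φ := fun x => ‖x - xs‖ ^ 2) (ρ := 1 / 2) (by norm_num) hepoch K 0
  refine h1.trans ?_
  rw [zero_sub, norm_neg]
  have h2 : (1 - (1 / 2 : ℝ) ^ K) * (2 * σ * ‖xs‖ ^ 2) ≤ 1 * (2 * σ * ‖xs‖ ^ 2) := by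
    gcongr
    have : (0 : ℝ) ≤ (1 / 2) ^ K := by positivity
    linarith
  linarith

open scoped Classical in
theorem expect_svrg_fail_le [NeZero n] (h : ApproxFamily g A H L τ) (hτ : 0 ≤ τ)
    (hlam : 0 ≤ lam) (hL : 0 ≤ L) (hγ : 0 < γ) (hγl : γ ≤ l) (hl : L + lam ≤ l)
    (hcoer : ∀ z, γ * ‖z‖ ^ 2 ≤ inner ℝ z (H z + lam • z)) (hσ : 60 * τ ^ 2 ≤ γ ^ 2 * σ)
    (hσ1 : σ ≤ 1 / 100) {T : ℕ} (hT : 3 ≤ γ ^ 2 / (16 * l ^ 2) * T) {K : ℕ} {p ξ : ℝ} (hp : 0 ≤ p)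
    (hξ : 0 ≤ ξ) (hK : (1 / 2) ^ K + 2 * σ ≤ p * (γ * ξ) ^ 2)
    {r xs : V} (hxs : H xs + lam • xs = r) :
    𝔼 ω, (if ‖svrg g lam (γ / (16 * l ^ 2)) T K r ω - xs‖ ≤ ξ * ‖r‖ then (0 : ℝ) else 1) ≤ p := by
  have hxr : γ * ‖xs‖ ≤ ‖r‖ := by
    have h1 := (hcoer xs).trans (real_inner_le_norm _ _)
    rw [hxs] at h1
    rcases (norm_nonneg xs).eq_or_lt with h0 | h0
    · rw [← h0, mul_zero]; exact norm_nonneg _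
    · refine le_of_mul_le_mul_left ?_ h0
      linarith
  have h1 := expect_ite_le_of_expect_le (t := (ξ * ‖r‖) ^ 2) (p := p)
    (Φ := fun ω => ‖svrg g lam (γ / (16 * l ^ 2)) T K r ω - xs‖ ^ 2) (by positivity) hp
    (fun _ => by positivity) ?_
  · refine le_trans (le_of_eq ?_) h1
    refine Finset.expect_congr rfl fun ω _ => ?_
    congr 1
    rw [sq_le_sq₀ (norm_nonneg _) (by positivity)]
  · refine (expect_norm_svrg_le h hτ hlam hL hγ hγl hl hcoer hσ hσ1 hT hxs K).trans ?_
    calc ((1 / 2) ^ K + 2 * σ) * ‖xs‖ ^ 2 ≤ p * (γ * ξ) ^ 2 * ‖xs‖ ^ 2 := by gcongr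
      _ = p * ξ ^ 2 * (γ * ‖xs‖) ^ 2 := by ring
      _ ≤ p * ξ ^ 2 * ‖r‖ ^ 2 := by gcongr
      _ = _ := by ring

end SVRG

/-! ### Uniform random seeds -/

section Uniform

open scoped Classical in
theorem real_uniformOn_univ {Ω : Type*} [Fintype Ω] [Nonempty Ω] [MeasurableSpace Ω]
    [MeasurableSingletonClass Ω] (q : Ω → Prop) :
    (ProbabilityTheory.uniformOn (Set.univ : Set Ω)).real {ω | q ω} =
      1 - 𝔼 ω, (if q ω then (0 : ℝ) else 1) := by
  have h1 : ∀ ω, (if q ω then (0 : ℝ) else 1) = 1 - (if q ω then (1 : ℝ) else 0) := fun ω => by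
    split_ifs <;> simp
  simp_rw [h1]
  rw [Finset.expect_sub_distrib, Fintype.expect_const, sub_sub_cancel,
    Fintype.expect_eq_sum_div_card, measureReal_def, ProbabilityTheory.uniformOn_univ,
    ENNReal.toReal_div]
  simp only [ENNReal.toReal_natCast]
  congr 1
  rw [Measure.count_apply_finite _ (Set.toFinite _), ENNReal.toReal_natCast, Finset.sum_boole]
  congr 2
  ext ω
  simp

/-- The start vector with coordinates `w₁, …, w_d ∈ {0, …, N - 1}`. -/
def gridVec {d N : ℕ} (w : Fin d → Fin N) : E d := WithLp.toLp 2 fun i => ((w i : ℕ) : ℝ)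

theorem norm_gridVec_le {d N : ℕ} (w : Fin d → Fin N) : ‖gridVec w‖ ≤ √d * N := by
  rw [EuclideanSpace.norm_eq]
  refine Real.sqrt_le_iff.2 ⟨by positivity, ?_⟩
  rw [mul_pow, Real.sq_sqrt (by positivity)]
  calc ∑ i, ‖(gridVec w) i‖ ^ 2 ≤ ∑ _i : Fin d, (N : ℝ) ^ 2 := by
        refine Finset.sum_le_sum fun i _ => ?_
        simp only [gridVec, Real.norm_natCast]
        gcongr
        exact (w i).2.le
    _ = d * (N : ℝ) ^ 2 := by simp

open scoped Classical in
/-- Anticoncentration of a uniformly random grid vector along a fixed direction: once all but one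
coordinate, at which the direction is large, are fixed, at most one value of that coordinate gives a
small inner product. -/
theorem expect_gridVec_fail_le {d N : ℕ} (hN : 0 < N) {u : E d} (hu : ‖u‖ = 1) :
    𝔼 w : Fin d → Fin N, (if 1 / (2 * √d) ≤ |inner ℝ u (gridVec w)| then (0 : ℝ) else 1) ≤
      1 / N := by
  have hsum : ∑ i, u i ^ 2 = 1 := by
    have := EuclideanSpace.norm_sq_eq u
    rw [hu] at this
    simpa using this.symm
  have hd : 0 < d := by
    rcases Nat.eq_zero_or_pos d with rfl | h
    · simp at hsum
    · exact h
  have hdR : (0 : ℝ) < d := by exact_mod_cast hd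
  obtain ⟨j, hj⟩ : ∃ j, 1 / √d ≤ |u j| := by
    by_contra! hcon
    have : ∑ i, u i ^ 2 < ∑ _i : Fin d, 1 / (d : ℝ) := by
      have : Nonempty (Fin d) := ⟨⟨0, hd⟩⟩
      refine Finset.sum_lt_sum_of_nonempty Finset.univ_nonempty fun i _ => ?_
      have h1 : (1 / √(d : ℝ)) ^ 2 = 1 / d := by rw [div_pow, Real.sq_sqrt hdR.le, one_pow]
      rw [← h1, sq_lt_sq, abs_of_pos (a := 1 / √(d : ℝ)) (by positivity)]
      exact hcon i
    simp [hsum, hdR.ne'] at this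
  set Bad := Finset.univ.filter fun w : Fin d → Fin N =>
    ¬ 1 / (2 * √d) ≤ |inner ℝ u (gridVec w)| with hBad
  have hcard : Bad.card ≤ N ^ (d - 1) := by
    have hinj : Set.InjOn (fun (w : Fin d → Fin N) (i : {i // i ≠ j}) => w i) Bad := by
      intro w hw w' hw' hww
      have hw := (Finset.mem_filter.1 hw).2
      have hw' := (Finset.mem_filter.1 hw').2
      push Not at hw hw'
      have hoff : ∀ i, i ≠ j → w i = w' i := fun i hi => congrFun hww ⟨i, hi⟩
      have hdiff : inner ℝ u (gridVec w) - inner ℝ u (gridVec w') =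
          u j * (((w j : ℕ) : ℝ) - ((w' j : ℕ) : ℝ)) := by
        simp only [PiLp.inner_apply, gridVec]
        rw [← Finset.sum_sub_distrib, Finset.sum_eq_single j]
        · simp; ring
        · intro i _ hi
          rw [hoff i hi, sub_self]
        · simp
      have h1 : |u j * (((w j : ℕ) : ℝ) - ((w' j : ℕ) : ℝ))| < 1 / √d := by
        rw [← hdiff]
        refine (abs_sub _ _).trans_lt ?_
        have : 1 / √(d : ℝ) = 1 / (2 * √d) + 1 / (2 * √d) := by field_simp; norm_num
        linarith
      rw [abs_mul] at h1
      have h2 : |((w j : ℕ) : ℝ) - ((w' j : ℕ) : ℝ)| < 1 := by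
        have h0 : 0 < |u j| := lt_of_lt_of_le (by positivity) hj
        by_contra! h
        nlinarith
      have h3 : w j = w' j := by
        rw [abs_lt] at h2
        apply Fin.ext
        have h4 : ((w j : ℕ) : ℝ) < ((w' j : ℕ) : ℝ) + 1 := by linarith
        have h5 : ((w' j : ℕ) : ℝ) < ((w j : ℕ) : ℝ) + 1 := by linarith
        have h4' : (w j : ℕ) < (w' j : ℕ) + 1 := by exact_mod_cast h4
        have h5' : (w' j : ℕ) < (w j : ℕ) + 1 := by exact_mod_cast h5
        omega
      funext i
      by_cases hi : i = j
      · rw [hi, h3]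
      · exact hoff i hi
    have := Finset.card_le_card_of_injOn (t := Finset.univ) _ (fun _ _ => Finset.mem_univ _) hinj
    refine this.trans ?_
    simp [Fintype.card_subtype_compl]
  rw [Fintype.expect_eq_sum_div_card]
  have hs : ∑ w : Fin d → Fin N,
      (if 1 / (2 * √d) ≤ |inner ℝ u (gridVec w)| then (0 : ℝ) else 1) = Bad.card := by
    rw [hBad, ← Finset.sum_boole]
    refine Finset.sum_congr rfl fun w _ => ?_
    split_ifs <;> simp_all
  rw [hs]
  have hNR : (0 : ℝ) < N := by exact_mod_cast hN
  have hc : ((Fintype.card (Fin d → Fin N) : ℕ) : ℝ) = N * (N : ℝ) ^ (d - 1) := by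
    rw [← pow_succ', Nat.sub_add_cancel hd]; simp
  rw [hc, div_le_div_iff₀ (by positivity) hNR, one_mul, mul_comm]
  gcongr
  exact_mod_cast hcard

end Uniform

/-! ### Oracle programs -/

section Programs

namespace Prog

variable {Q R α β S ι : Type}

@[simp]
theorem result_bind (O : Q → R) (p : Prog Q R α) (f : α → Prog Q R β) :
    (p.bind f).result O = (f (p.result O)).result O := by
  induction p with
  | ret a => rfl
  | ask q k ih => exact ih _

@[simp]
theorem calls_bind (O : Q → R) (p : Prog Q R α) (f : α → Prog Q R β) :
    (p.bind f).calls O = p.calls O + (f (p.result O)).calls O := by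
  induction p with
  | ret a => simp [bind, calls, result]
  | ask q k ih =>
    simp only [bind, calls, result, ih]
    omega

@[simp]
theorem result_ret (O : Q → R) (a : α) : (ret a : Prog Q R α).result O = a := rfl

@[simp]
theorem calls_ret (O : Q → R) (a : α) : (ret a : Prog Q R α).calls O = 0 := rfl

/-- The program that performs `iter` with an update rule that calls the oracle. -/
def iter (f : S → ι → Prog Q R S) : (N : ℕ) → (Fin N → ι) → S → Prog Q R S
  | 0, _, s => .ret s
  | N + 1, ω, s => (f s (ω 0)).bind fun s' => iter f N (fun k => ω k.succ) s'

theorem result_iter (O : Q → R) (f : S → ι → Prog Q R S) (N : ℕ) (ω : Fin N → ι) (s : S) :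
    (iter f N ω s).result O = NCD3.iter (fun s i => (f s i).result O) N ω s := by
  induction N generalizing s with
  | zero => rfl
  | succ N ih => simp only [iter, NCD3.iter, result_bind, ih]

theorem calls_iter_le (O : Q → R) {f : S → ι → Prog Q R S} {c : ℕ}
    (h : ∀ s i, (f s i).calls O ≤ c) (N : ℕ) (ω : Fin N → ι) (s : S) :
    (iter f N ω s).calls O ≤ N * c := by
  induction N generalizing s with
  | zero => simp [iter]
  | succ N ih =>
    simp only [iter, calls_bind]
    have := h s (ω 0)
    have := ih (fun k => ω k.succ) ((f s (ω 0)).result O)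
    rw [Nat.succ_mul]
    omega

end Prog

variable {Q R : Type} {d n : ℕ}

/-- The program computing `avgMap`, from programs for the `n` maps. -/
def avgProg (hv : Fin n → E d → Prog Q R (E d)) (u : E d) : Prog Q R (E d) :=
  (Prog.iter (fun s i => (hv i u).bind fun r => .ret (s + r)) n id 0).bind fun s =>
    .ret ((n : ℝ)⁻¹ • s)

/-- The program computing `svrgEpoch`. -/
def svrgEpochProg (hv : Fin n → E d → Prog Q R (E d)) (lam η : ℝ) (T : ℕ) (r a : E d)
    (ω : Fin T → Fin n) : Prog Q R (E d) :=
  (avgProg hv a).bind fun G => Prog.iter (fun x i => (hv i (x - a)).bind fun y =>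
    .ret (x - η • (y + G + lam • x - r))) T ω a

/-- The program computing `svrg`. -/
def svrgProg (hv : Fin n → E d → Prog Q R (E d)) (lam η : ℝ) (T K : ℕ) (r : E d)
    (ω : Fin K → Fin T → Fin n) : Prog Q R (E d) :=
  Prog.iter (svrgEpochProg hv lam η T r) K ω 0

/-- The Chebyshev iteration for `β (H + lam)⁻¹`, in which the linear systems are solved by SVRG. -/
def chebyshev (g : Fin n → E d → E d) (lam η β : ℝ) (T K m : ℕ) (w : E d)
    (ω : Fin m → Fin K → Fin T → Fin n) : E d :=
  (iter (chebStep fun y ω => β • svrg g lam η T K y ω) m ω (0, w)).2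

/-- The program computing `chebyshev`. -/
def chebyshevProg (hv : Fin n → E d → Prog Q R (E d)) (lam η β : ℝ) (T K m : ℕ) (w : E d)
    (ω : Fin m → Fin K → Fin T → Fin n) : Prog Q R (E d) :=
  (Prog.iter (fun (s : E d × E d) ω => (svrgProg hv lam η T K s.2 ω).bind fun x =>
    .ret (s.2, (2 : ℝ) • β • x - s.1)) m ω (0, w)).bind fun s => .ret s.2

open scoped Classical in
/-- Normalize `y` and accept it if its computed Rayleigh quotient is at most `-θ`. -/
def testProg (hv : Fin n → E d → Prog Q R (E d)) (θ : ℝ) (y : E d) : Prog Q R (Option (E d)) :=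
  if y = 0 then .ret none else
    (avgProg hv (‖y‖⁻¹ • y)).bind fun z =>
      .ret (if inner ℝ (‖y‖⁻¹ • y) z ≤ -θ then some (‖y‖⁻¹ • y) else none)

/-- Run the programs `p 0, …, p (J - 1)` until one of them returns a vector. -/
def firstSome {J : ℕ} (p : Fin J → Prog Q R (Option (E d))) : Prog Q R (Option (E d)) :=
  Prog.iter (fun (s : Option (E d)) j => match s with
    | some v => .ret (some v)
    | none => p j) J id none

variable {hv : Fin n → E d → Prog Q R (E d)} {O : Q → R}

theorem result_avgProg (u : E d) :
    (avgProg hv u).result O = avgMap (fun i u => (hv i u).result O) u := by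
  simp only [avgProg, Prog.result_bind, Prog.result_iter, Prog.result_ret, avgMap]
  rw [iter_add (fun i => (hv i u).result O)]
  simp

theorem result_svrgEpochProg (lam η : ℝ) (T : ℕ) (r a : E d) (ω : Fin T → Fin n) :
    (svrgEpochProg hv lam η T r a ω).result O =
      svrgEpoch (fun i u => (hv i u).result O) lam η T r a ω := by
  simp only [svrgEpochProg, Prog.result_bind, Prog.result_iter, Prog.result_ret, result_avgProg]
  rfl

theorem result_svrgProg (lam η : ℝ) (T K : ℕ) (r : E d) (ω : Fin K → Fin T → Fin n) :
    (svrgProg hv lam η T K r ω).result O =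
      svrg (fun i u => (hv i u).result O) lam η T K r ω := by
  simp only [svrgProg, Prog.result_iter, result_svrgEpochProg]
  rfl

theorem result_chebyshevProg (lam η β : ℝ) (T K m : ℕ) (w : E d)
    (ω : Fin m → Fin K → Fin T → Fin n) :
    (chebyshevProg hv lam η β T K m w ω).result O =
      chebyshev (fun i u => (hv i u).result O) lam η β T K m w ω := by
  simp only [chebyshevProg, Prog.result_iter, Prog.result_bind, Prog.result_ret, result_svrgProg]
  rfl

variable {c : ℕ}

theorem calls_avgProg_le (hc : ∀ i u, (hv i u).calls O ≤ c) (u : E d) :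
    (avgProg hv u).calls O ≤ n * c := by
  simp only [avgProg, Prog.calls_bind, Prog.calls_ret, add_zero]
  exact Prog.calls_iter_le O (fun s i => by simpa using hc i u) _ _ _

theorem calls_svrgProg_le (hc : ∀ i u, (hv i u).calls O ≤ c) (lam η : ℝ) (T K : ℕ) (r : E d)
    (ω : Fin K → Fin T → Fin n) :
    (svrgProg hv lam η T K r ω).calls O ≤ K * (n * c + T * c) := by
  refine Prog.calls_iter_le O (fun a ω => ?_) _ _ _
  simp only [svrgEpochProg, Prog.calls_bind]
  exact Nat.add_le_add (calls_avgProg_le hc a)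
    (Prog.calls_iter_le O (fun s i => by simpa using hc i _) _ _ _)

theorem calls_chebyshevProg_le (hc : ∀ i u, (hv i u).calls O ≤ c) (lam η β : ℝ) (T K m : ℕ)
    (w : E d) (ω : Fin m → Fin K → Fin T → Fin n) :
    (chebyshevProg hv lam η β T K m w ω).calls O ≤ m * (K * (n * c + T * c)) := by
  simp only [chebyshevProg, Prog.calls_bind, Prog.calls_ret, add_zero]
  refine Prog.calls_iter_le O (fun s ω => ?_) _ _ _
  simpa using calls_svrgProg_le hc lam η T K s.2 ω

theorem calls_testProg_le (hc : ∀ i u, (hv i u).calls O ≤ c) (θ : ℝ) (y : E d) :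
    (testProg hv θ y).calls O ≤ n * c := by
  unfold testProg
  split_ifs
  · simp
  · simpa using calls_avgProg_le hc _

theorem calls_firstSome_le {J : ℕ} {p : Fin J → Prog Q R (Option (E d))}
    (hc : ∀ j, (p j).calls O ≤ c) : (firstSome p).calls O ≤ J * c := by
  refine Prog.calls_iter_le O (fun s j => ?_) _ _ _
  rcases s with _ | v
  · exact hc j
  · simp

theorem result_testProg_eq_some {θ : ℝ} {y v : E d} (h : (testProg hv θ y).result O = some v) :
    ‖v‖ = 1 ∧ inner ℝ v (avgMap (fun i u => (hv i u).result O) v) ≤ -θ := by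
  unfold testProg at h
  split_ifs at h with hy
  · simp at h
  · rw [Prog.result_bind, result_avgProg, Prog.result_ret] at h
    split_ifs at h with h1
    obtain rfl := Option.some.inj h
    refine ⟨?_, h1⟩
    rw [norm_smul, norm_inv, norm_norm, inv_mul_cancel₀ (norm_ne_zero_iff.2 hy)]

theorem result_testProg_ne_none {θ : ℝ} {y : E d} (hy : y ≠ 0)
    (h : inner ℝ (‖y‖⁻¹ • y) (avgMap (fun i u => (hv i u).result O) (‖y‖⁻¹ • y)) ≤ -θ) :
    (testProg hv θ y).result O ≠ none := by
  unfold testProg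
  rw [if_neg hy, Prog.result_bind, result_avgProg, Prog.result_ret, if_pos h]
  simp

theorem result_firstSome_eq_some {J : ℕ} {p : Fin J → Prog Q R (Option (E d))} {v : E d}
    (h : (firstSome p).result O = some v) : ∃ j, (p j).result O = some v := by
  have key : ∀ (N : ℕ) (ω : Fin N → Fin J) (s : Option (E d)), (Prog.iter
      (fun (s : Option (E d)) j => match s with
        | some v => .ret (some v)
        | none => p j) N ω s).result O = some v → s = some v ∨ ∃ j, (p j).result O = some v := by
    intro N
    induction N with
    | zero => exact fun ω s h => .inl h
    | succ N ih =>
      intro ω s h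
      simp only [Prog.iter, Prog.result_bind] at h
      rcases ih _ _ h with h1 | h1
      · rcases s with _ | u
        · exact .inr ⟨_, h1⟩
        · exact .inl h1
      · exact .inr h1
  simpa using key J id none h

theorem result_firstSome_ne_none {J : ℕ} {p : Fin J → Prog Q R (Option (E d))} {j : Fin J}
    (h : (p j).result O ≠ none) : (firstSome p).result O ≠ none := by
  have key : ∀ (N : ℕ) (ω : Fin N → Fin J) (s : Option (E d)), (s ≠ none ∨ ∃ k, ω k = j) →
      (Prog.iter (fun (s : Option (E d)) j => match s with
        | some v => .ret (some v)
        | none => p j) N ω s).result O ≠ none := by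
    intro N
    induction N with
    | zero => rintro ω s (h | ⟨k, -⟩); exacts [h, k.elim0]
    | succ N ih =>
      intro ω s hs
      simp only [Prog.iter, Prog.result_bind]
      refine ih _ _ ?_
      rcases s with _ | u
      · rcases hs with hs | ⟨k, hk⟩
        · exact absurd rfl hs
        · refine Fin.cases (fun hk => .inl ?_) (fun k hk => .inr ⟨k, hk⟩) k hk
          rw [hk]
          exact h
      · exact .inl (by simp)
  exact key J id none (.inr ⟨j, rfl⟩)

end Programs

/-! ### One scale of the search -/

section Filter

variable {V ι J : Type*} [NormedAddCommGroup V] [InnerProductSpace ℝ V] [Fintype ι]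

/-- With `M = (5s/4 + γ) (H + 2s + γ)⁻¹`, the eigenvalues of `H` above `-3s/4` are mapped into
`[0, 1]`, where Chebyshev polynomials stay small, and those below `-s` beyond `1 + s/(8γ)`, where
they grow like `exp (m √(s/γ) / 4)`. -/
theorem inner_apply_chebyshev_le (b : OrthonormalBasis ι ℝ V) {H : V →L[ℝ] V} {lam : ι → ℝ}
    (hH : ∀ i, H (b i) = lam i • b i) {L s γ A B ξ : ℝ} (hs : 0 < s) (hsL : s ≤ L) (hsγ : s ≤ γ)
    (hlamL : ∀ i, lam i ≤ L) (hlams : ∀ i, -(2 * s) ≤ lam i) {i₀ : ι} (hi₀ : lam i₀ ≤ -s) {m : ℕ}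
    (hB : (m + 1) * Real.exp (m * (2 * √(s / γ))) ≤ B) (hξ : 0 ≤ ξ) (hmB : 4 * ξ * m * B ^ 2 ≤ 1)
    {w : V} (hw : w ≠ 0) (hA0 : 0 < A)
    (hA : (1 + A) * ‖w‖ ≤ Real.exp (m * (√(s / γ) / 4)) / 2 * |inner ℝ (b i₀) w|)
    (hAR : 8 * L * (((m : ℝ) + 1) ^ 2 + 1) ≤ s * A ^ 2) {P : V → J → V} {ω : Fin m → J}
    (hgood : GoodRun (chebStep P) (fun t i =>
      ‖P t.2 i - diagOp b (fun i => (5 / 4 * s + γ) / (lam i + (2 * s + γ))) t.2‖ ≤ ξ * ‖t.2‖)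
        m ω (0, w)) :
    (iter (chebStep P) m ω (0, w)).2 ≠ 0 ∧
      inner ℝ (iter (chebStep P) m ω (0, w)).2 (H (iter (chebStep P) m ω (0, w)).2) ≤
        -(3 / 5 * s) * ‖(iter (chebStep P) m ω (0, w)).2‖ ^ 2 := by
  have hγ : 0 < γ := hs.trans_le hsγ
  set q := s / γ with hq
  have hq0 : 0 < q := by positivity
  have hq1 : q ≤ 1 := (div_le_one hγ).2 hsγ
  have hqγ : s = q * γ := by rw [hq]; field_simp
  set x : ι → ℝ := fun i => (5 / 4 * s + γ) / (lam i + (2 * s + γ)) with hx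
  have hden : ∀ i, γ ≤ lam i + (2 * s + γ) := fun i => by linarith [hlams i]
  have hx0 : ∀ i, 0 ≤ x i := fun i => div_nonneg (by positivity) (hγ.le.trans (hden i))
  have hxu : ∀ i, x i ≤ 1 + 5 / 4 * q := fun i => by
    rw [hx, div_le_iff₀ (hγ.trans_le (hden i))]
    have : (1 + 5 / 4 * q) * γ ≤ (1 + 5 / 4 * q) * (lam i + (2 * s + γ)) := by
      gcongr; exact hden i
    nlinarith
  have hxl : 1 + q / 8 ≤ x i₀ := by
    rw [hx, le_div_iff₀ (hγ.trans_le (hden i₀))]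
    have : (1 + q / 8) * (lam i₀ + (2 * s + γ)) ≤ (1 + q / 8) * (s + γ) :=
      mul_le_mul_of_nonneg_left (by linarith) (by positivity)
    nlinarith
  have hφ : 0 ≤ 2 * √q := by positivity
  have hU : ∀ k : ℕ, k ≤ m → ∀ i, |(Polynomial.Chebyshev.U ℝ (k : ℤ)).eval (x i)| ≤ B := by
    intro k hk i
    refine (abs_eval_U_le_exp hφ (hx0 i)
      ((hxu i).trans (one_add_le_cosh_two_mul_sqrt hq0.le)) k).trans (le_trans ?_ hB)
    gcongr
  have hB1 : 1 ≤ B := by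
    refine le_trans ?_ hB
    have h1 : (1 : ℝ) ≤ Real.exp (m * (2 * √q)) := Real.one_le_exp (by positivity)
    have h2 : (1 : ℝ) ≤ (m : ℝ) + 1 := by linarith [Nat.cast_nonneg (α := ℝ) m]
    exact one_le_mul_of_one_le_of_one_le h2 h1
  have hdev := norm_iter_chebStep_sub_le b hB1 hξ hU hmB hgood
  set y := (iter (chebStep P) m ω (0, w)).2 with hy
  set c : ι → ℝ := fun i => (Polynomial.Chebyshev.U ℝ (m : ℤ)).eval (x i) with hc
  have hdev' : ‖y - diagOp b c w‖ ≤ ‖w‖ := hdev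
  have hci₀ : (1 + A) * ‖w‖ ≤ |c i₀| * |inner ℝ (b i₀) w| := by
    refine hA.trans ?_
    gcongr
    exact (exp_le_eval_U (by positivity) ((cosh_sqrt_div_four_le hq0.le hq1).trans hxl) m).trans
      (le_abs_self _)
  refine ⟨?_, ?_⟩
  · intro hy0
    rw [hy0, zero_sub, norm_neg] at hdev'
    have h1 : |c i₀| * |inner ℝ (b i₀) w| ≤ ‖w‖ := by
      rw [← abs_mul, ← inner_diagOp b c w i₀]
      refine (abs_real_inner_le_norm _ _).trans ?_
      rw [b.norm_eq_one, one_mul]; exact hdev'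
    nlinarith [norm_pos_iff.2 hw]
  · refine inner_apply_le_of_filter b hH hs hsL hlamL hi₀ (R := m + 1) (A := A) (c := c) ?_ hdev'
      hA0.le hci₀ hAR
    intro i hi
    refine abs_eval_U_le (hx0 i) ?_ m
    rw [hx, div_le_one (hγ.trans_le (hden i))]
    linarith

end Filter

/-! ### Parameters -/

section Parameters

/-- The regularization at scale `s`: the shifted Hessian has condition number at most `√n`, so that
an epoch of SVRG costs `O(n)` products. -/
def reg (n : ℕ) (L s : ℝ) : ℝ := max s (L / √n)

/-- The number of Chebyshev steps at scale `s`. -/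
def numSteps (n : ℕ) (L D s : ℝ) : ℕ := ⌈40 * Real.log D * √(reg n L s / s)⌉₊

/-- The number of SVRG epochs per linear system. -/
def numEpochs (D : ℝ) : ℕ := ⌈724 * Real.log D⌉₊

/-- The number of grid points per coordinate of the start vector. -/
def gridSize (D : ℝ) : ℕ := ⌈2 * D⌉₊ + 1

instance (D : ℝ) : NeZero (gridSize D) := ⟨Nat.succ_ne_zero _⟩

variable {n d : ℕ} {L s D : ℝ}

theorem le_reg : s ≤ reg n L s := le_max_left _ _

theorem one_le_log (hD : 11 ≤ D) : 1 ≤ Real.log D := by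
  rw [Real.le_log_iff_exp_le (by linarith)]
  linarith [Real.exp_one_lt_three]

theorem log_le_self' (hD : 11 ≤ D) : Real.log D ≤ D := by
  have := Real.log_le_sub_one_of_pos (show (0 : ℝ) < D by linarith)
  linarith

theorem reg_le (hs : s ≤ L) (hL : 0 ≤ L) [NeZero n] : reg n L s ≤ L := by
  refine max_le hs (div_le_self hL ?_)
  rw [Real.one_le_sqrt]
  exact_mod_cast Nat.one_le_iff_ne_zero.2 (NeZero.ne n)

theorem sq_le_mul_reg_sq (hL : 0 ≤ L) [NeZero n] : L ^ 2 ≤ n * reg n L s ^ 2 := by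
  have hn : (0 : ℝ) < n := by exact_mod_cast Nat.pos_of_ne_zero (NeZero.ne n)
  have h1 : L / √n ≤ reg n L s := le_max_right _ _
  have h2 : (L / √n) ^ 2 ≤ reg n L s ^ 2 := by gcongr
  rw [div_pow, Real.sq_sqrt hn.le, div_le_iff₀ hn] at h2
  linarith

theorem one_le_sqrt_reg_div (hs : 0 < s) : 1 ≤ √(reg n L s / s) := by
  rw [Real.one_le_sqrt, one_le_div hs]
  exact le_reg

theorem numSteps_le (hD : 11 ≤ D) (hs : 0 < s) :
    (numSteps n L D s : ℝ) ≤ 41 * Real.log D * √(reg n L s / s) := by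
  have h1 := one_le_log hD
  have h2 := one_le_sqrt_reg_div (n := n) (L := L) hs
  have h3 := Nat.ceil_lt_add_one (a := 40 * Real.log D * √(reg n L s / s)) (by positivity)
  have h4 : 1 ≤ Real.log D * √(reg n L s / s) := one_le_mul_of_one_le_of_one_le h1 h2
  rw [numSteps]
  linarith

theorem sqrt_reg_div_le (hs : 0 < s) (hsL : s ≤ L) [NeZero n] (hLs : L / s ≤ D) (hD : 11 ≤ D) :
    √(reg n L s / s) ≤ D := by
  refine Real.sqrt_le_iff.2 ⟨by linarith, ?_⟩
  have : reg n L s / s ≤ L / s := by gcongr; exact reg_le hsL (hs.le.trans hsL)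
  nlinarith

theorem numSteps_add_one_le (hD : 11 ≤ D) (hs : 0 < s) (hsL : s ≤ L) [NeZero n]
    (hLs : L / s ≤ D) : (numSteps n L D s : ℝ) + 1 ≤ D ^ 4 := by
  have h1 := numSteps_le (n := n) (L := L) hD hs
  have h2 := sqrt_reg_div_le (n := n) hs hsL hLs hD
  have h3 := log_le_self' hD
  have h4 := one_le_log hD
  have h5 : 41 * Real.log D * √(reg n L s / s) ≤ 41 * D * D := by gcongr
  have h6 : 42 * (D * D) ≤ (D * D) * (D * D) := by
    gcongr; nlinarith
  nlinarith

theorem exp_mul_log (k : ℕ) (hD : 0 < D) : Real.exp (k * Real.log D) = D ^ k := by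
  rw [Real.exp_nat_mul, Real.exp_log hD]

theorem pow_le_exp_numSteps (hD : 11 ≤ D) (hs : 0 < s) :
    D ^ 10 ≤ Real.exp (numSteps n L D s * (√(s / reg n L s) / 4)) := by
  have hγ : 0 < reg n L s := hs.trans_le le_reg
  rw [← exp_mul_log 10 (by linarith)]
  refine Real.exp_le_exp.2 ?_
  have h1 : 40 * Real.log D * √(reg n L s / s) ≤ numSteps n L D s := Nat.le_ceil _
  have h2 : √(reg n L s / s) * √(s / reg n L s) = 1 := by
    rw [← Real.sqrt_mul (by positivity)]
    rw [div_mul_div_comm, mul_comm, div_self (by positivity), Real.sqrt_one]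
  calc ((10 : ℕ) : ℝ) * Real.log D
      = 10 * Real.log D * (√(reg n L s / s) * √(s / reg n L s)) := by rw [h2]; push_cast; ring
    _ = (40 * Real.log D * √(reg n L s / s)) * (√(s / reg n L s) / 4) := by ring
    _ ≤ _ := by gcongr

theorem exp_numSteps_le (hD : 11 ≤ D) (hs : 0 < s) :
    Real.exp (numSteps n L D s * (2 * √(s / reg n L s))) ≤ D ^ 82 := by
  have hγ : 0 < reg n L s := hs.trans_le le_reg
  rw [← exp_mul_log 82 (by linarith)]
  refine Real.exp_le_exp.2 ?_
  have h1 := numSteps_le (n := n) (L := L) hD hs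
  have h2 : √(reg n L s / s) * √(s / reg n L s) = 1 := by
    rw [← Real.sqrt_mul (by positivity)]
    rw [div_mul_div_comm, mul_comm, div_self (by positivity), Real.sqrt_one]
  calc (numSteps n L D s : ℝ) * (2 * √(s / reg n L s))
      ≤ (41 * Real.log D * √(reg n L s / s)) * (2 * √(s / reg n L s)) := by gcongr
    _ = 82 * Real.log D * (√(reg n L s / s) * √(s / reg n L s)) := by ring
    _ = _ := by rw [h2]; push_cast; ring

theorem half_pow_numEpochs_le (hD : 11 ≤ D) : (1 / 2 : ℝ) ^ numEpochs D ≤ (D ^ 362)⁻¹ := by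
  have h1 : 724 * Real.log D ≤ numEpochs D := Nat.le_ceil _
  have h2 : (1 / 2 : ℝ) ^ numEpochs D = Real.exp (-(numEpochs D * Real.log 2)) := by
    rw [← mul_neg, Real.exp_nat_mul, Real.exp_neg, Real.exp_log (by norm_num)]
    norm_num
  rw [h2, ← exp_mul_log 362 (by linarith), ← Real.exp_neg]
  refine Real.exp_le_exp.2 (neg_le_neg ?_)
  have h3 : (1 : ℝ) / 2 ≤ Real.log 2 := by linarith [Real.log_two_gt_d9]
  have h4 := one_le_log hD
  calc ((362 : ℕ) : ℝ) * Real.log D = (724 * Real.log D) * (1 / 2) := by push_cast; ring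
    _ ≤ numEpochs D * Real.log 2 := by gcongr

end Parameters

/-! ### Success probability at the right scale -/

section Scale

/-- The random seed of one scale: the grid coordinates of the start vector, and the component sampled
in each SVRG step of each epoch of each Chebyshev step. -/
abbrev ScaleSeed (d n : ℕ) (L D s : ℝ) : Type :=
  (Fin d → Fin (gridSize D)) ×
    (Fin (numSteps n L D s) → Fin (numEpochs D) → Fin (768 * n) → Fin n)

/-- The candidate direction of negative curvature at scale `s`. -/
def scaleVec {d n : ℕ} (g : Fin n → E d → E d) (L D s : ℝ) (ω : ScaleSeed d n L D s) : E d :=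
  chebyshev g (2 * s + reg n L s) (reg n L s / (16 * (4 * L) ^ 2)) (5 / 4 * s + reg n L s)
    (768 * n) (numEpochs D) (numSteps n L D s) (gridVec ω.1) ω.2

variable {d n : ℕ} {g : Fin n → E d → E d} {A : Fin n → E d →L[ℝ] E d} {H : E d →L[ℝ] E d}
  {L τ s D δ : ℝ}

/-- The SVRG substitute for the product `(5s/4 + γ) (H + 2s + γ)⁻¹ y`. -/
def scaleProd (g : Fin n → E d → E d) (L D s : ℝ) (y : E d)
    (ω : Fin (numEpochs D) → Fin (768 * n) → Fin n) : E d :=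
  (5 / 4 * s + reg n L s) • svrg g (2 * s + reg n L s) (reg n L s / (16 * (4 * L) ^ 2)) (768 * n)
    (numEpochs D) y ω

/-- The SVRG substitute at the current iterate has relative error at most `D⁻¹⁷⁷`. -/
def ScaleGood (b : OrthonormalBasis (Fin d) ℝ (E d)) (lam : Fin d → ℝ) (g : Fin n → E d → E d)
    (L D s : ℝ) (t : E d × E d) (ω : Fin (numEpochs D) → Fin (768 * n) → Fin n) : Prop :=
  ‖scaleProd g L D s t.2 ω - diagOp b
    (fun i => (5 / 4 * s + reg n L s) / (lam i + (2 * s + reg n L s))) t.2‖ ≤ (D ^ 177)⁻¹ * ‖t.2‖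

open scoped Classical in
theorem expect_not_scaleGood_le [NeZero n] (h : ApproxFamily g A H L τ) (hτ : 0 ≤ τ)
    (hs : 0 < s) (hsL : s ≤ L) (hD : 11 ≤ D) (hτs : τ ≤ s * (D ^ 182)⁻¹)
    (b : OrthonormalBasis (Fin d) ℝ (E d)) {lam : Fin d → ℝ} (hH : ∀ i, H (b i) = lam i • b i)
    (hlams : ∀ i, -(2 * s) ≤ lam i) (t : E d × E d) :
    𝔼 ω, (if ScaleGood b lam g L D s t ω then (0 : ℝ) else 1) ≤ (D ^ 6)⁻¹ := by
  have hD0 : 0 < D := by linarith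
  have hD1 : 1 ≤ D := by linarith
  have hL : 0 < L := hs.trans_le hsL
  set γ := reg n L s with hγdef
  have hsγ : s ≤ γ := le_reg
  have hγ : 0 < γ := hs.trans_le hsγ
  have hγL : γ ≤ L := reg_le hsL hL.le
  set β := 5 / 4 * s + γ with hβ
  have hβ0 : 0 < β := by positivity
  set x : Fin d → ℝ := fun i => β / (lam i + (2 * s + γ)) with hx
  set K := numEpochs D with hK
  have hden : ∀ i, 0 < lam i + (2 * s + γ) := fun i => by linarith [hlams i]
  set ξ : ℝ := (D ^ 177)⁻¹ with hξ
  have hξ0 : 0 < ξ := by positivity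
  -- the linear systems
  have hcoer : ∀ z, γ * ‖z‖ ^ 2 ≤ inner ℝ z (H z + (2 * s + γ) • z) := by
    intro z
    rw [inner_add_right, inner_smul_right, real_inner_self_eq_norm_sq, inner_apply_eq_sum b hH]
    have : -(2 * s) * ‖z‖ ^ 2 ≤ ∑ i, lam i * inner ℝ (b i) z ^ 2 := by
      rw [norm_sq_eq_sum_inner b, Finset.mul_sum]
      exact Finset.sum_le_sum fun i _ => by gcongr; exact hlams i
    linarith
  have hsolve : ∀ r, H (diagOp b (fun i => (lam i + (2 * s + γ))⁻¹) r) +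
      (2 * s + γ) • diagOp b (fun i => (lam i + (2 * s + γ))⁻¹) r = r := by
    intro r
    have hHd : ∀ y, H y = diagOp b lam y := fun y => by
      conv_lhs => rw [← b.sum_repr' y]
      simp only [map_sum, map_smul, hH, smul_smul, diagOp, LinearMap.coe_mk, AddHom.coe_mk]
      exact Finset.sum_congr rfl fun i _ => by ring_nf
    refine ext_inner_basis b fun i => ?_
    rw [hHd, inner_add_right, inner_smul_right, inner_diagOp, inner_diagOp]
    have := (hden i).ne'
    field_simp
  have hMx : ∀ r, diagOp b x r = β • diagOp b (fun i => (lam i + (2 * s + γ))⁻¹) r := fun r => by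
    refine ext_inner_basis b fun i => ?_
    rw [inner_smul_right, inner_diagOp, inner_diagOp, hx]
    ring
  have hσ : 60 * τ ^ 2 ≤ γ ^ 2 * (D ^ 362)⁻¹ := by
    have h1 : τ ^ 2 ≤ (γ * (D ^ 182)⁻¹) ^ 2 := by
      gcongr
      exact hτs.trans (by gcongr)
    have h2 : (γ * (D ^ 182)⁻¹) ^ 2 * D ^ 2 = γ ^ 2 * (D ^ 362)⁻¹ := by
      field_simp
    have h3 : (60 : ℝ) ≤ D ^ 2 := by nlinarith
    rw [← h2]
    nlinarith [sq_nonneg τ]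
  have hT : 3 ≤ γ ^ 2 / (16 * (4 * L) ^ 2) * ((768 * n : ℕ) : ℝ) := by
    have h1 : L ^ 2 ≤ n * γ ^ 2 := sq_le_mul_reg_sq hL.le
    rw [div_mul_eq_mul_div, le_div_iff₀ (by positivity)]
    push_cast
    nlinarith
  have hprec : (1 / 2 : ℝ) ^ K + 2 * (D ^ 362)⁻¹ ≤ (D ^ 6)⁻¹ * (γ * (ξ / β)) ^ 2 := by
    have h1 : (1 / 2 : ℝ) ^ K ≤ (D ^ 362)⁻¹ := half_pow_numEpochs_le hD
    have h2 : 4 / 9 * ξ ≤ γ * (ξ / β) := by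
      have : 4 / 9 ≤ γ / β := by rw [le_div_iff₀ hβ0, hβ]; linarith
      calc 4 / 9 * ξ ≤ γ / β * ξ := by gcongr
        _ = _ := by ring
    have h3 : (4 / 9 * ξ) ^ 2 ≤ (γ * (ξ / β)) ^ 2 := by gcongr
    have h4 : (D ^ 6)⁻¹ * (4 / 9 * ξ) ^ 2 = 16 / 81 * D ^ 2 * (D ^ 362)⁻¹ := by
      rw [hξ]; field_simp; ring
    have h5 : 3 * (D ^ 362)⁻¹ ≤ 16 / 81 * D ^ 2 * (D ^ 362)⁻¹ := by
      gcongr; nlinarith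
    have h6 : (D ^ 6)⁻¹ * (4 / 9 * ξ) ^ 2 ≤ (D ^ 6)⁻¹ * (γ * (ξ / β)) ^ 2 := by gcongr
    linarith
  have hσ1 : (D ^ 362)⁻¹ ≤ 1 / 100 := by
    calc (D ^ 362)⁻¹ ≤ (D ^ 2)⁻¹ :=
          inv_anti₀ (by positivity) (pow_le_pow_right₀ hD1 (by norm_num))
      _ ≤ 1 / 100 := by
          rw [← one_div]; exact one_div_le_one_div_of_le (by norm_num) (by nlinarith)
  have h1 := expect_svrg_fail_le h hτ (lam := 2 * s + γ) (γ := γ) (l := 4 * L)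
    (by positivity) hL.le hγ (by linarith) (by linarith) hcoer hσ hσ1 hT (K := K) (p := (D ^ 6)⁻¹)
    (ξ := ξ / β) (by positivity) (by positivity) hprec (hsolve t.2)
  refine le_trans (le_of_eq (Finset.expect_congr rfl fun ω _ => ?_)) h1
  have : ScaleGood b lam g L D s t ω ↔
      ‖svrg g (2 * s + γ) (γ / (16 * (4 * L) ^ 2)) (768 * n) K t.2 ω -
        diagOp b (fun i => (lam i + (2 * s + γ))⁻¹) t.2‖ ≤ ξ / β * ‖t.2‖ := by
    have h2 : ScaleGood b lam g L D s t ω ↔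
        ‖β • svrg g (2 * s + γ) (γ / (16 * (4 * L) ^ 2)) (768 * n) K t.2 ω -
          diagOp b x t.2‖ ≤ ξ * ‖t.2‖ := Iff.rfl
    rw [h2, hMx, ← smul_sub, norm_smul, Real.norm_of_nonneg hβ0.le, div_mul_eq_mul_div,
      le_div_iff₀ hβ0, mul_comm β]
  simp only [this]

/-- The precisions are powers of `D⁻¹`: the relative error `D⁻¹⁷⁷` of a product is small enough for
the amplification `4mB²` with `B = D⁸⁶`. -/
theorem inner_apply_scaleVec_le [NeZero n] (hs : 0 < s) (hsL : s ≤ L) (hD : 11 ≤ D) (hdD : d ≤ D)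
    (hLs : L / s ≤ D) (b : OrthonormalBasis (Fin d) ℝ (E d)) {lam : Fin d → ℝ}
    (hH : ∀ i, H (b i) = lam i • b i) (hlamL : ∀ i, lam i ≤ L) (hlams : ∀ i, -(2 * s) ≤ lam i)
    {i₀ : Fin d} (hi₀ : lam i₀ ≤ -s) {ω : ScaleSeed d n L D s}
    (hg1 : 1 / (2 * √d) ≤ |inner ℝ (b i₀) (gridVec ω.1)|)
    (hg2 : GoodRun (chebStep (scaleProd g L D s)) (ScaleGood b lam g L D s) (numSteps n L D s) ω.2
      (0, gridVec ω.1)) :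
    scaleVec g L D s ω ≠ 0 ∧ inner ℝ (scaleVec g L D s ω) (H (scaleVec g L D s ω)) ≤
      -(3 / 5 * s) * ‖scaleVec g L D s ω‖ ^ 2 := by
  have hD0 : 0 < D := by linarith
  have hD1 : 1 ≤ D := by linarith
  have hm4 : (numSteps n L D s : ℝ) + 1 ≤ D ^ 4 := numSteps_add_one_le hD hs hsL hLs
  have hd : (0 : ℝ) < d := by exact_mod_cast i₀.pos
  have hN2 : (gridSize D : ℝ) ≤ 3 * D := by
    have := Nat.ceil_lt_add_one (a := 2 * D) (by linarith)
    rw [gridSize]; push_cast; linarith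
  have hi0 : 0 < |inner ℝ (b i₀) (gridVec ω.1)| := lt_of_lt_of_le (by positivity) hg1
  have hw0 : gridVec ω.1 ≠ 0 := by
    intro h0
    rw [h0] at hi0
    simp at hi0
  have hwn : ‖gridVec ω.1‖ ≤ 6 * D ^ 2 * |inner ℝ (b i₀) (gridVec ω.1)| := by
    calc ‖gridVec ω.1‖ ≤ √d * gridSize D := norm_gridVec_le ω.1
      _ = 2 * d * gridSize D * (1 / (2 * √d)) := by
        field_simp
        rw [Real.sq_sqrt hd.le, mul_comm]
      _ ≤ 2 * D * (3 * D) * |inner ℝ (b i₀) (gridVec ω.1)| := by gcongr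
      _ = _ := by ring
  refine inner_apply_chebyshev_le b hH hs hsL le_reg hlamL hlams hi₀ (A := D ^ 6)
    (B := D ^ 86) (ξ := (D ^ 177)⁻¹) ?_ (by positivity) ?_ hw0 (by positivity) ?_ ?_ hg2
  · calc ((numSteps n L D s : ℝ) + 1) * Real.exp (numSteps n L D s * (2 * √(s / reg n L s)))
        ≤ D ^ 4 * D ^ 82 := by
          gcongr
          exact exp_numSteps_le hD hs
      _ = D ^ 86 := by ring
  · calc 4 * (D ^ 177)⁻¹ * numSteps n L D s * (D ^ 86) ^ 2
        ≤ D * (D ^ 177)⁻¹ * D ^ 4 * (D ^ 86) ^ 2 := by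
          gcongr <;> linarith
      _ = 1 := by field_simp
  · have h1 : D ^ 10 ≤ Real.exp (numSteps n L D s * (√(s / reg n L s) / 4)) :=
      pow_le_exp_numSteps hD hs
    have h2 : (1 + D ^ 6) * (6 * D ^ 2) ≤ D ^ 10 / 2 := by
      have h3 : 1 ≤ D ^ 6 := one_le_pow₀ hD1
      have h4 : (24 : ℝ) ≤ D ^ 2 := by nlinarith
      calc (1 + D ^ 6) * (6 * D ^ 2) ≤ (D ^ 6 + D ^ 6) * (6 * D ^ 2) := by gcongr
        _ = 24 * D ^ 8 / 2 := by ring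
        _ ≤ D ^ 2 * D ^ 8 / 2 := by gcongr
        _ = D ^ 10 / 2 := by ring
    calc (1 + D ^ 6) * ‖gridVec ω.1‖
        ≤ (1 + D ^ 6) * (6 * D ^ 2 * |inner ℝ (b i₀) (gridVec ω.1)|) := by gcongr
      _ = (1 + D ^ 6) * (6 * D ^ 2) * |inner ℝ (b i₀) (gridVec ω.1)| := by ring
      _ ≤ D ^ 10 / 2 * |inner ℝ (b i₀) (gridVec ω.1)| := by gcongr
      _ ≤ _ := by gcongr
  · have h1 : L ≤ D * s := by rwa [div_le_iff₀ hs] at hLs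
    have h2 : ((numSteps n L D s : ℝ) + 1) ^ 2 ≤ (D ^ 4) ^ 2 := by gcongr
    have h3 : (1 : ℝ) ≤ (D ^ 4) ^ 2 := one_le_pow₀ (one_le_pow₀ hD1)
    have h4 : (16 : ℝ) ≤ D ^ 3 := by
      calc (16 : ℝ) ≤ 11 ^ 3 := by norm_num
        _ ≤ D ^ 3 := by gcongr
    calc 8 * L * (((numSteps n L D s : ℝ) + 1) ^ 2 + 1)
        ≤ 8 * (D * s) * ((D ^ 4) ^ 2 + (D ^ 4) ^ 2) := by gcongr
      _ = s * D ^ 9 * 16 := by ring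
      _ ≤ s * D ^ 9 * D ^ 3 := by gcongr
      _ = s * (D ^ 6) ^ 2 := by ring

open scoped Classical in
/-- The union bound over the start vector and the linear systems. -/
theorem expect_scaleVec_fail_le [NeZero n] (h : ApproxFamily g A H L τ) (hτ : 0 ≤ τ)
    (hs : 0 < s) (hsL : s ≤ L) (hD : 11 ≤ D) (hdD : d ≤ D) (hLs : L / s ≤ D) (hδ : 0 < δ)
    (hδD : 1 / δ ≤ D) (hτs : τ ≤ s * (D ^ 182)⁻¹)
    (b : OrthonormalBasis (Fin d) ℝ (E d)) {lam : Fin d → ℝ} (hH : ∀ i, H (b i) = lam i • b i)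
    (hlamL : ∀ i, lam i ≤ L) (hlams : ∀ i, -(2 * s) ≤ lam i) {i₀ : Fin d} (hi₀ : lam i₀ ≤ -s) :
    𝔼 ω : ScaleSeed d n L D s, (if scaleVec g L D s ω ≠ 0 ∧
      inner ℝ (scaleVec g L D s ω) (H (scaleVec g L D s ω)) ≤
        -(3 / 5 * s) * ‖scaleVec g L D s ω‖ ^ 2 then (0 : ℝ) else 1) ≤ δ := by
  have hD0 : 0 < D := by linarith
  have hm4 : (numSteps n L D s : ℝ) + 1 ≤ D ^ 4 := numSteps_add_one_le hD hs hsL hLs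
  have hN : 0 < gridSize D := Nat.succ_pos _
  have hN1 : 2 * D ≤ gridSize D := by
    rw [gridSize]; push_cast; linarith [Nat.le_ceil (2 * D)]
  have hrun : ∀ w : E d, 𝔼 ω, (if GoodRun (chebStep (scaleProd g L D s)) (ScaleGood b lam g L D s)
      (numSteps n L D s) ω (0, w) then (0 : ℝ) else 1) ≤ numSteps n L D s * (D ^ 6)⁻¹ :=
    fun w => expect_not_goodRun_le
      (expect_not_scaleGood_le h hτ hs hsL hD hτs b hH hlams) _ (0, w)
  have hgrid := expect_gridVec_fail_le (d := d) hN (b.norm_eq_one i₀)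
  have hδ1 : 1 ≤ D * δ := by rwa [div_le_iff₀ hδ] at hδD
  have hbudget : 1 / (gridSize D : ℝ) + numSteps n L D s * (D ^ 6)⁻¹ ≤ δ := by
    have h1 : 1 / (gridSize D : ℝ) ≤ δ / 2 := by
      rw [div_le_iff₀ (by exact_mod_cast hN)]
      nlinarith
    have h2 : numSteps n L D s * (D ^ 6)⁻¹ ≤ δ / 2 := by
      calc numSteps n L D s * (D ^ 6)⁻¹ ≤ D ^ 4 * (D ^ 6)⁻¹ := by gcongr; linarith
        _ = (D * D)⁻¹ := by field_simp
        _ ≤ δ / 2 := by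
          rw [inv_le_iff_one_le_mul₀ (by positivity)]
          nlinarith
    linarith
  refine le_trans ?_ hbudget
  calc 𝔼 ω : ScaleSeed d n L D s, (if scaleVec g L D s ω ≠ 0 ∧
          inner ℝ (scaleVec g L D s ω) (H (scaleVec g L D s ω)) ≤
            -(3 / 5 * s) * ‖scaleVec g L D s ω‖ ^ 2 then (0 : ℝ) else 1)
      ≤ 𝔼 ω : ScaleSeed d n L D s,
          ((if 1 / (2 * √d) ≤ |inner ℝ (b i₀) (gridVec ω.1)| then (0 : ℝ) else 1) +
            (if GoodRun (chebStep (scaleProd g L D s)) (ScaleGood b lam g L D s)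
              (numSteps n L D s) ω.2 (0, gridVec ω.1) then (0 : ℝ) else 1)) := by
        refine Finset.expect_le_expect fun ω _ => ?_
        by_cases hg1 : 1 / (2 * √d) ≤ |inner ℝ (b i₀) (gridVec ω.1)|
        swap
        · rw [if_neg hg1]
          split_ifs <;> norm_num
        by_cases hg2 : GoodRun (chebStep (scaleProd g L D s)) (ScaleGood b lam g L D s)
            (numSteps n L D s) ω.2 (0, gridVec ω.1)
        swap
        · rw [if_neg hg2]
          split_ifs <;> norm_num
        rw [if_pos hg1, if_pos hg2, add_zero, if_pos
          (inner_apply_scaleVec_le hs hsL hD hdD hLs b hH hlamL hlams hi₀ hg1 hg2)]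
    _ = 𝔼 w : Fin d → Fin (gridSize D),
          ((if 1 / (2 * √d) ≤ |inner ℝ (b i₀) (gridVec w)| then (0 : ℝ) else 1) +
            𝔼 ω, (if GoodRun (chebStep (scaleProd g L D s)) (ScaleGood b lam g L D s)
              (numSteps n L D s) ω (0, gridVec w) then (0 : ℝ) else 1)) := by
        rw [← Finset.univ_product_univ, Finset.expect_product]
        refine Finset.expect_congr rfl fun w _ => ?_
        rw [Finset.expect_add_distrib]
        exact congrArg₂ _ (Finset.expect_const Finset.univ_nonempty
          (if 1 / (2 * √d) ≤ |inner ℝ (b i₀) (gridVec w)| then (0 : ℝ) else 1)) rfl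
    _ ≤ 𝔼 w : Fin d → Fin (gridSize D),
          ((if 1 / (2 * √d) ≤ |inner ℝ (b i₀) (gridVec w)| then (0 : ℝ) else 1) +
            numSteps n L D s * (D ^ 6)⁻¹) :=
        Finset.expect_le_expect fun w _ => by gcongr; exact hrun _
    _ ≤ _ := by
        rw [Finset.expect_add_distrib, Fintype.expect_const]
        gcongr

end Scale

/-! ### Decrease along a direction of negative curvature -/

section Taylor

variable {d : ℕ} {f : E d → ℝ}

theorem le_pow_of_hasDerivAt_le {u u' : ℝ → ℝ} {c : ℝ} {k : ℕ} (hu : ∀ t, HasDerivAt u (u' t) t)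
    (h0 : u 0 = 0) (hle : ∀ t, 0 ≤ t → u' t ≤ c * t ^ k) {t : ℝ} (ht : 0 ≤ t) :
    u t ≤ c / (k + 1) * t ^ (k + 1) := by
  have hd : ∀ t, HasDerivAt (fun t => u t - c / (k + 1) * t ^ (k + 1)) (u' t - c * t ^ k) t := by
    intro t
    have h1 := (hasDerivAt_pow (k + 1) t).const_mul (c / (k + 1))
    refine ((hu t).sub h1).congr_deriv ?_
    rw [Nat.add_sub_cancel]
    push_cast
    field_simp
  have hanti : AntitoneOn (fun t => u t - c / (k + 1) * t ^ (k + 1)) (Set.Ici 0) := by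
    refine antitoneOn_of_deriv_nonpos (convex_Ici 0)
      (fun t _ => (hd t).continuousAt.continuousWithinAt)
      (fun t _ => (hd t).differentiableAt.differentiableWithinAt) fun t ht => ?_
    rw [interior_Ici] at ht
    rw [(hd t).deriv]
    linarith [hle t (le_of_lt ht)]
  have := hanti (Set.mem_Ici.2 le_rfl) (Set.mem_Ici.2 ht) ht
  simp [h0] at this
  linarith

theorem hasDerivAt_line {G : Type*} [NormedAddCommGroup G] [NormedSpace ℝ G] {h : E d → G}
    (hh : Differentiable ℝ h) (x v : E d) (t : ℝ) :
    HasDerivAt (fun t : ℝ => h (x + t • v)) (fderiv ℝ h (x + t • v) v) t := by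
  have h1 : HasDerivAt (fun t : ℝ => x + t • v) v t := by
    simpa using ((hasDerivAt_id t).smul_const v).const_add x
  exact (hh _).hasFDerivAt.comp_hasDerivAt t h1

theorem inner_trilinear_eq_sum (B : E d →L[ℝ] E d →L[ℝ] E d) (v : E d) :
    inner ℝ v (B v v) = ∑ i, ∑ j, ∑ k, (B (EuclideanSpace.single i 1)
      (EuclideanSpace.single j 1)) k * (v i * v j * v k) := by
  have hv : v = ∑ i, v i • EuclideanSpace.single i (1 : ℝ) := by
    have := (EuclideanSpace.basisFun (Fin d) ℝ).sum_repr v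
    simpa using this.symm
  have hB : B v v = ∑ i, ∑ j, (v i * v j) • B (EuclideanSpace.single i 1)
      (EuclideanSpace.single j 1) := by
    have h1 : ∀ u w : E d, B u w = ∑ i, ∑ j, (u i * w j) • B (EuclideanSpace.single i 1)
        (EuclideanSpace.single j 1) := by
      intro u w
      have hu : u = ∑ i, u i • EuclideanSpace.single i (1 : ℝ) := by
        have := (EuclideanSpace.basisFun (Fin d) ℝ).sum_repr u
        simpa using this.symm
      have hw : w = ∑ i, w i • EuclideanSpace.single i (1 : ℝ) := by
        have := (EuclideanSpace.basisFun (Fin d) ℝ).sum_repr w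
        simpa using this.symm
      conv_lhs => rw [hu, hw]
      simp only [map_sum, map_smul, _root_.sum_apply, _root_.smul_apply,
        Finset.smul_sum, smul_smul]
      rw [Finset.sum_comm]
      simp only [mul_comm]
    exact h1 v v
  rw [hB, inner_sum]
  refine Finset.sum_congr rfl fun i _ => ?_
  rw [inner_sum]
  refine Finset.sum_congr rfl fun j _ => ?_
  rw [inner_smul_right, PiLp.inner_apply, Finset.mul_sum]
  refine Finset.sum_congr rfl fun k _ => ?_
  simp
  ring

theorem sum_sq_mul_mul (v : E d) :
    ∑ i, ∑ j, ∑ k, (v i * v j * v k) ^ 2 = (‖v‖ ^ 2) ^ 3 := by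
  have h : ‖v‖ ^ 2 = ∑ i, v i ^ 2 := by simpa using EuclideanSpace.norm_sq_eq v
  rw [h, pow_succ, pow_two, Finset.sum_mul_sum]
  simp only [Finset.sum_mul, Finset.mul_sum]
  refine Finset.sum_congr rfl fun i _ => Finset.sum_congr rfl fun j _ => ?_
  exact Finset.sum_congr rfl fun k _ => by ring

/-- The Frobenius norm dominates the trilinear form on unit vectors. -/
theorem IsThirdLipschitz.inner_sub_le {L : ℝ} (h : IsThirdLipschitz L f) (x y : E d) {v : E d}
    (hv : ‖v‖ = 1) :
    inner ℝ v (fderiv ℝ (hess f) x v v) - inner ℝ v (fderiv ℝ (hess f) y v v) ≤ L * ‖x - y‖ := by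
  refine le_trans ?_ (h.2.2.2 x y)
  rw [inner_trilinear_eq_sum, inner_trilinear_eq_sum, ← Finset.sum_sub_distrib]
  simp_rw [← Finset.sum_sub_distrib, ← sub_mul]
  refine Real.le_sqrt_of_sq_le ?_
  have hcs := Finset.sum_mul_sq_le_sq_mul_sq (Finset.univ : Finset (Fin d × Fin d × Fin d))
    (fun p => third f x p.1 p.2.1 p.2.2 - third f y p.1 p.2.1 p.2.2)
    (fun p => v p.1 * v p.2.1 * v p.2.2)
  simp only [← Finset.univ_product_univ, Finset.sum_product] at hcs
  rw [sum_sq_mul_mul, hv] at hcs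
  simpa [third] using hcs

theorem symm_second_difference_le_of_third {L : ℝ} (h : IsThirdLipschitz L f) (x : E d) {v : E d}
    (hv : ‖v‖ = 1) {t : ℝ} (ht : 0 ≤ t) :
    f (x + t • v) + f (x - t • v) - 2 * f x ≤
      inner ℝ v (hess f x v) * t ^ 2 + L / 12 * t ^ 4 := by
  have e1 : ∀ t, HasDerivAt (fun t : ℝ => f (x + t • v))
      (inner ℝ v (gradient f (x + t • v))) t := fun t => by
    have := hasDerivAt_line h.1 x v t
    rwa [← inner_gradient_left, real_inner_comm] at this
  have e2 : ∀ t, HasDerivAt (fun t : ℝ => inner ℝ v (gradient f (x + t • v)))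
      (inner ℝ v (hess f (x + t • v) v)) t := fun t => by
    simpa [hess] using (hasDerivAt_const t v).inner ℝ (hasDerivAt_line h.2.1 x v t)
  have e3 : ∀ t, HasDerivAt (fun t : ℝ => inner ℝ v (hess f (x + t • v) v))
      (inner ℝ v (fderiv ℝ (hess f) (x + t • v) v v)) t := fun t => by
    have h1 : HasDerivAt (fun t : ℝ => hess f (x + t • v) v)
        (fderiv ℝ (hess f) (x + t • v) v v) t := by
      simpa using (hasDerivAt_line h.2.2.1 x v t).clm_apply (hasDerivAt_const t v)
    simpa using (hasDerivAt_const t v).inner ℝ h1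
  have hneg : ∀ {w w' : ℝ → ℝ}, (∀ t, HasDerivAt w (w' t) t) →
      ∀ t, HasDerivAt (fun t => w (-t)) (-w' (-t)) t := fun {w w'} hw t => by
    exact ((hw (-t)).comp t (hasDerivAt_neg t)).congr_deriv (by ring)
  set φ := fun t : ℝ => f (x + t • v) with hφ
  set φ₁ := fun t : ℝ => inner ℝ v (gradient f (x + t • v)) with hφ₁
  set φ₂ := fun t : ℝ => inner ℝ v (hess f (x + t • v) v) with hφ₂
  set φ₃ := fun t : ℝ => inner ℝ v (fderiv ℝ (hess f) (x + t • v) v v) with hφ₃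
  have u3 : ∀ t, 0 ≤ t → φ₃ t - φ₃ (-t) ≤ (2 * L) * t ^ 1 := fun t ht => by
    have := h.inner_sub_le (x + t • v) (x + (-t) • v) hv
    have e : x + t • v - (x + (-t) • v) = (2 * t) • v := by module
    rw [e, norm_smul, hv, Real.norm_of_nonneg (by positivity)] at this
    simp only [hφ₃]
    linarith
  have u2 : ∀ t, 0 ≤ t → φ₂ t + φ₂ (-t) - 2 * φ₂ 0 ≤ L * t ^ 2 := fun t ht => by
    have := le_pow_of_hasDerivAt_le (u := fun t => φ₂ t + φ₂ (-t) - 2 * φ₂ 0)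
      (u' := fun t => φ₃ t - φ₃ (-t))
      (fun t => (((e3 t).add (hneg e3 t)).sub_const (2 * φ₂ 0)).congr_deriv
        (sub_eq_add_neg _ _).symm)
      (by simp; ring) u3 ht
    norm_num at this ⊢
    linarith
  have u1 : ∀ t, 0 ≤ t → φ₁ t - φ₁ (-t) - 2 * φ₂ 0 * t ≤ L / 3 * t ^ 3 := fun t ht => by
    have := le_pow_of_hasDerivAt_le (u := fun t => φ₁ t - φ₁ (-t) - 2 * φ₂ 0 * t)
      (u' := fun t => φ₂ t + φ₂ (-t) - 2 * φ₂ 0)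
      (fun t => (((e2 t).sub (hneg e2 t)).sub
        ((hasDerivAt_id t).const_mul (2 * φ₂ 0))).congr_deriv (by simp only [hφ₂]; ring))
      (by simp) u2 ht
    norm_num at this ⊢
    linarith
  have u0 := le_pow_of_hasDerivAt_le (u := fun t => φ t + φ (-t) - 2 * φ 0 - φ₂ 0 * t ^ 2)
      (u' := fun t => φ₁ t - φ₁ (-t) - 2 * φ₂ 0 * t)
      (fun t => ((((e1 t).add (hneg e1 t)).sub_const (2 * φ 0)).sub
        ((hasDerivAt_pow 2 t).const_mul (φ₂ 0))).congr_deriv (by simp only [hφ₁]; push_cast; ring))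
      (by simp; ring) u1 ht
  have e0 : φ₂ 0 = inner ℝ v (hess f x v) := by simp [hφ₂]
  have e00 : φ 0 = f x := by simp [hφ]
  have em : φ (-t) = f (x - t • v) := by simp [hφ, sub_eq_add_neg]
  rw [e0, e00, em] at u0
  norm_num at u0
  simp only [hφ] at u0
  linarith

theorem symm_second_difference_le_of_smooth {L : ℝ} (h : IsSmooth L f) (x : E d) {v : E d}
    (hv : ‖v‖ = 1) {t : ℝ} (ht : 0 ≤ t) :
    f (x + t • v) + f (x - t • v) - 2 * f x ≤ L * t ^ 2 := by
  have e1 : ∀ t, HasDerivAt (fun t : ℝ => f (x + t • v))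
      (inner ℝ v (gradient f (x + t • v))) t := fun t => by
    have := hasDerivAt_line h.1 x v t
    rwa [← inner_gradient_left, real_inner_comm] at this
  set φ := fun t : ℝ => f (x + t • v) with hφ
  set φ₁ := fun t : ℝ => inner ℝ v (gradient f (x + t • v)) with hφ₁
  have e1' : ∀ t, HasDerivAt (fun t => φ (-t)) (-φ₁ (-t)) t := fun t => by
    exact ((e1 (-t)).comp t (hasDerivAt_neg t)).congr_deriv (by simp only [hφ₁]; ring)
  have u1 : ∀ t, 0 ≤ t → φ₁ t - φ₁ (-t) ≤ (2 * L) * t ^ 1 := fun t ht => by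
    have h1 := h.2 (x + t • v) (x + (-t) • v)
    have e : x + t • v - (x + (-t) • v) = (2 * t) • v := by module
    rw [e, norm_smul, hv, Real.norm_of_nonneg (by positivity)] at h1
    simp only [hφ₁]
    rw [← inner_sub_right]
    have h2 := real_inner_le_norm v (gradient f (x + t • v) - gradient f (x + (-t) • v))
    rw [hv] at h2
    linarith
  have u0 := le_pow_of_hasDerivAt_le (u := fun t => φ t + φ (-t) - 2 * φ 0)
      (u' := fun t => φ₁ t - φ₁ (-t))
      (fun t => (((e1 t).add (e1' t)).sub_const (2 * φ 0)).congr_deriv (sub_eq_add_neg _ _).symm)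
      (by simp; ring) u1 ht
  have e00 : φ 0 = f x := by simp [hφ]
  have em : φ (-t) = f (x - t • v) := by simp [hφ, sub_eq_add_neg]
  rw [e00, em] at u0
  norm_num at u0
  simp only [hφ] at u0
  linarith

/-- With the step `η = √(3ε/L₃)`, the gain `η²ε/4` of the curvature term is twice the fourth-order
error `L₃η⁴/24`. -/
theorem second_difference_le_of_inner_le {L₃ ε : ℝ} (hL₃ : 0 < L₃) (hε : 0 < ε)
    (h : IsThirdLipschitz L₃ f) (x : E d) {v : E d} (hv : ‖v‖ = 1)
    (hneg : inner ℝ v (hess f x v) ≤ -ε / 2) :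
    f (x + √(3 * ε / L₃) • v) + f (x - √(3 * ε / L₃) • v) - 2 * f x ≤
      -(2 * (3 * ε ^ 2 / (8 * L₃))) := by
  have h1 := symm_second_difference_le_of_third h x hv (Real.sqrt_nonneg (3 * ε / L₃))
  have h2 : √(3 * ε / L₃) ^ 2 = 3 * ε / L₃ := Real.sq_sqrt (by positivity)
  have h4 : √(3 * ε / L₃) ^ 4 = (√(3 * ε / L₃) ^ 2) ^ 2 := by ring
  rw [h4, h2] at h1
  refine h1.trans ?_
  have h3 : inner ℝ v (hess f x v) * (3 * ε / L₃) ≤ -ε / 2 * (3 * ε / L₃) := by gcongr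
  refine (add_le_add_left h3 _).trans (le_of_eq ?_)
  field_simp
  ring

end Taylor

/-! ### The step with a random sign -/

section RandomSign

variable {d : ℕ} {Q R : Type} {f : E d → ℝ} {O : Q → R} {A : RandAlg Q R (Option (E d))}

theorem integral_rademacher (h : ℝ → ℝ) : ∫ ζ, h ζ ∂rademacher = (h 1 + h (-1)) / 2 := by
  rw [rademacher, integral_smul_measure, integral_add_measure (integrable_dirac (by simp))
    (integrable_dirac (by simp)), integral_dirac, integral_dirac]
  simp
  ring

theorem ae_rademacher {q : ℝ → Prop} (h1 : q 1) (h2 : q (-1)) : ∀ᵐ ζ ∂rademacher, q ζ := by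
  refine Measure.ae_smul_measure ?_ _
  rw [ae_add_measure_iff]
  exact ⟨by rwa [ae_dirac_eq], by rwa [ae_dirac_eq]⟩

theorem output_ncd3 (L₃ ε : ℝ) (x : E d) (ω : A.Ω) (ζ : ℝ) :
    (ncd3 L₃ ε x A).output O (ω, ζ) =
      (A.output O ω).map fun v => x + (ζ * √(3 * ε / L₃)) • v := by
  simp only [RandAlg.output, ncd3, Prog.result_bind]
  rcases (A.prog ω).result O with _ | v <;> rfl

theorem calls_ncd3 (L₃ ε : ℝ) (x : E d) (s : (ncd3 L₃ ε x A).Ω) :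
    (ncd3 L₃ ε x A).calls O s = A.calls O s.1 := by
  simp only [RandAlg.calls, ncd3, Prog.calls_bind]
  rcases (A.prog s.1).result O with _ | v <;> rfl

variable {x : E d} {L₁ L₃ ε δ : ℝ}

theorem IsApproxNC.exists_of_success {ω : A.Ω} (hlam : lambdaMin (hess f x) < -ε)
    (hω : (A.output O ω = none ∧ -ε ≤ lambdaMin (hess f x)) ∨
      ∃ v, A.output O ω = some v ∧ inner ℝ v (hess f x v) ≤ -ε / 2) :
    ∃ v, A.output O ω = some v ∧ inner ℝ v (hess f x v) ≤ -ε / 2 :=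
  hω.resolve_left fun h => absurd hlam (not_lt.2 h.2)

theorem IsApproxNC.decreasesWithProb (hA : IsApproxNC A O f x ε δ) (hL₃ : 0 < L₃) (hε : 0 < ε)
    (h : IsThirdLipschitz L₃ f) (hlam : lambdaMin (hess f x) < -ε) :
    DecreasesWithProb A O f x L₃ ε δ := by
  refine hA.success.trans (measureReal_mono fun ω hω => ?_)
  obtain ⟨v, hv, hneg⟩ := IsApproxNC.exists_of_success hlam hω
  have h1 := second_difference_le_of_inner_le hL₃ hε h x (hA.unit ω v hv) hneg
  refine ⟨fun ζ => by rw [output_ncd3, hv]; simp, ?_⟩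
  simp only [output_ncd3, hv, Option.map_some, Option.getD_some]
  rw [integral_rademacher]
  simp only [one_mul, neg_one_mul, neg_smul, ← sub_eq_add_neg]
  linarith

/-- The value at the new point, and `f x` when the output is `⊥`, as a function of the output vector
`o` of the subroutine and the sign. -/
theorem getD_output_ncd3 (ω : A.Ω) (ζ : ℝ) [Decidable (A.output O ω = none)] :
    ((ncd3 L₃ ε x A).output O (ω, ζ)).getD x =
      if A.output O ω = none then x else x + (ζ * √(3 * ε / L₃)) • (A.output O ω).getD 0 := by
  rw [output_ncd3]
  split_ifs with h
  · simp [h]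
  · obtain ⟨v, hv⟩ := Option.ne_none_iff_exists'.1 h
    simp [hv]

theorem IsApproxNC.measurableSet_preimage (hA : IsApproxNC A O f x ε δ) {S : Set (Option (E d))}
    (hS : MeasurableSet (some ⁻¹' S)) : MeasurableSet (A.output O ⁻¹' S) := by
  refine hA.measurable ?_
  change MeasurableSet[borel (E d)] (some ⁻¹' S)
  rwa [← BorelSpace.measurable_eq (α := E d)]

theorem IsApproxNC.measurable_getD (hA : IsApproxNC A O f x ε δ) :
    Measurable fun ω => (A.output O ω).getD 0 := by
  intro S hS
  exact hA.measurableSet_preimage (S := (fun o => Option.getD o 0) ⁻¹' S) hS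

theorem IsApproxNC.integrable (hA : IsApproxNC A O f x ε δ) (hf : Continuous f) :
    Integrable (fun s => f (((ncd3 L₃ ε x A).output O s).getD x) - f x) (ncd3 L₃ ε x A).P := by
  classical
  change Integrable (fun s : A.Ω × ℝ => f (((ncd3 L₃ ε x A).output O s).getD x) - f x)
    (A.P.prod rademacher)
  set η := √(3 * ε / L₃) with hη
  obtain ⟨C, hC⟩ := (isCompact_closedBall x η).exists_bound_of_continuousOn
    (f := fun y => f y - f x) (by fun_prop)
  have hmeas : Measurable fun s : A.Ω × ℝ =>
      f (((ncd3 L₃ ε x A).output O s).getD x) - f x := by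
    refine (hf.measurable.comp ?_).sub_const _
    have : (fun s : A.Ω × ℝ => ((ncd3 L₃ ε x A).output O s).getD x) = fun s =>
        if A.output O s.1 = none then x else x + (s.2 * η) • (A.output O s.1).getD 0 := by
      funext s
      exact getD_output_ncd3 s.1 s.2
    rw [this]
    refine Measurable.ite ?_ measurable_const ?_
    · exact measurable_fst (hA.measurableSet_preimage (S := {none})
        ((MeasurableSet.empty).congr (by ext; simp)))
    · exact ((measurable_snd.mul_const η).smul (hA.measurable_getD.comp measurable_fst)).const_add x
  refine Integrable.of_bound hmeas.aestronglyMeasurable C ?_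
  have hae : ∀ᵐ s : A.Ω × ℝ ∂(A.P.prod rademacher), s.2 = 1 ∨ s.2 = -1 :=
    Measure.quasiMeasurePreserving_snd.ae (ae_rademacher (q := fun ζ => ζ = 1 ∨ ζ = -1) (by simp)
      (by simp))
  filter_upwards [hae] with s hs
  refine hC _ ?_
  rw [Metric.mem_closedBall, dist_eq_norm, show s = (s.1, s.2) from rfl, output_ncd3]
  have hη0 : 0 ≤ η := Real.sqrt_nonneg _
  rcases ho : A.output O s.1 with _ | v
  · simpa using hη0
  · have hv := hA.unit _ _ ho
    rcases hs with hs | hs <;> simp [hs, norm_smul, hv, abs_of_nonneg hη0, ← hη]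

theorem IsApproxNC.decreasesInExpectation (hA : IsApproxNC A O f x ε δ) (hL₁ : 0 < L₁)
    (hL₃ : 0 < L₃) (hε : 0 < ε) (hsm : IsSmooth L₁ f) (h : IsThirdLipschitz L₃ f)
    (hlam : lambdaMin (hess f x) < -ε) (hδ : δ ≤ ε / (3 * ε + 8 * L₁)) :
    DecreasesInExpectation A O f x L₃ ε := by
  classical
  have hint := hA.integrable (L₃ := L₃) hsm.1.continuous
  refine ⟨hint, ?_⟩
  change Integrable (fun s : A.Ω × ℝ => f (((ncd3 L₃ ε x A).output O s).getD x) - f x)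
    (A.P.prod rademacher) at hint
  change ∫ s : A.Ω × ℝ, (f (((ncd3 L₃ ε x A).output O s).getD x) - f x)
    ∂(A.P.prod rademacher) ≤ _
  rw [integral_prod _ hint]
  have hleft := hint.integral_prod_left
  set a := 3 * ε ^ 2 / (8 * L₃) with ha
  set c := 3 * ε * L₁ / (2 * L₃) with hc
  have hc0 : 0 < c := by positivity
  have ha0 : 0 < a := by positivity
  set S := {ω | ∃ v, A.output O ω = some v ∧ inner ℝ v (hess f x v) ≤ -ε / 2} with hS
  have hSm : MeasurableSet S := by
    refine hA.measurableSet_preimage (S := {o | ∃ v, o = some v ∧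
      inner ℝ v (hess f x v) ≤ -ε / 2}) ?_
    have : some ⁻¹' {o : Option (E d) | ∃ v, o = some v ∧ inner ℝ v (hess f x v) ≤ -ε / 2} =
        {v | inner ℝ v (hess f x v) ≤ -ε / 2} := by
      ext v; simp
    rw [this]
    exact (isClosed_le (by fun_prop) continuous_const).measurableSet
  have hSP : 1 - δ ≤ A.P.real S :=
    hA.success.trans (measureReal_mono fun ω hω => IsApproxNC.exists_of_success hlam hω)
  have hpt : ∀ ω, ∫ ζ, (f (((ncd3 L₃ ε x A).output O (ω, ζ)).getD x) - f x) ∂rademacher ≤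
      c + S.indicator (fun _ => -(a + c)) ω := by
    intro ω
    simp only [output_ncd3]
    rw [integral_rademacher]
    rcases ho : A.output O ω with _ | v
    · have : ω ∉ S := by rintro ⟨v, hv, -⟩; rw [ho] at hv; simp at hv
      simp [this, hc0.le]
    · have hv := hA.unit _ _ ho
      simp only [Option.map_some, Option.getD_some, one_mul, neg_one_mul, neg_smul,
        ← sub_eq_add_neg]
      by_cases hω : ω ∈ S
      · rw [Set.indicator_of_mem hω]
        obtain ⟨v', hv', hneg⟩ := hω
        obtain rfl : v = v' := by rw [ho] at hv'; exact Option.some.inj hv'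
        have := second_difference_le_of_inner_le hL₃ hε h x hv hneg
        linarith
      · rw [Set.indicator_of_notMem hω]
        have h1 := symm_second_difference_le_of_smooth hsm x hv (Real.sqrt_nonneg (3 * ε / L₃))
        rw [Real.sq_sqrt (by positivity)] at h1
        have h2 : L₁ * (3 * ε / L₃) = 2 * c := by rw [hc]; field_simp
        linarith
  have hind : Integrable (S.indicator fun _ : A.Ω => -(a + c)) A.P :=
    (integrable_const _).indicator hSm
  calc ∫ ω, ∫ ζ, (f (((ncd3 L₃ ε x A).output O (ω, ζ)).getD x) - f x) ∂rademacher ∂A.P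
      ≤ ∫ ω, (c + S.indicator (fun _ => -(a + c)) ω) ∂A.P :=
        integral_mono hleft ((integrable_const _).add hind) hpt
    _ = c - (a + c) * A.P.real S := by
        rw [integral_add (integrable_const _) hind, integral_indicator_const _ hSm]
        simp
        ring
    _ ≤ c - (a + c) * (1 - δ) := by gcongr
    _ = -a + (a + c) * δ := by ring
    _ ≤ -a + (a + c) * (ε / (3 * ε + 8 * L₁)) := by gcongr
    _ ≤ -(ε ^ 2 / (8 * L₃)) := by
        have h1 : (a + c) * (ε / (3 * ε + 8 * L₁)) ≤ 2 * (ε ^ 2 / (8 * L₃)) := by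
          rw [← mul_div_assoc, div_le_iff₀ (by positivity)]
          have e1 : (a + c) * ε = ε ^ 2 / (8 * L₃) * (3 * ε + 12 * L₁) := by
            rw [ha, hc]; field_simp; ring
          rw [e1]
          have : 0 ≤ ε ^ 2 / (8 * L₃) := by positivity
          nlinarith
        have h2 : a = 3 * (ε ^ 2 / (8 * L₃)) := by rw [ha]; ring
        linarith

end RandomSign

/-! ### Hessians of finite sums -/

section Hessian

variable {d n : ℕ}

theorem gradient_avg {F : Fin n → E d → ℝ} (hF : ∀ i, Differentiable ℝ (F i)) (x : E d) :
    gradient (avg F) x = (n : ℝ)⁻¹ • ∑ i, gradient (F i) x := by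
  have h : fderiv ℝ (avg F) x = (n : ℝ)⁻¹ • ∑ i, fderiv ℝ (F i) x := by
    have h1 : avg F = fun x => (n : ℝ)⁻¹ * ∑ i, F i x := by
      funext y; simp [avg]
    rw [h1, fderiv_const_mul, fderiv_fun_sum]
    · exact fun i _ => hF i x
    · exact DifferentiableAt.fun_sum fun i _ => hF i x
  refine ext_inner_right ℝ fun v => ?_
  rw [inner_gradient_left, h, inner_smul_left, sum_inner]
  simp

theorem hess_avg {F : Fin n → E d → ℝ} (hF : ∀ i, Differentiable ℝ (F i))
    (hF' : ∀ i, Differentiable ℝ fun y => gradient (F i) y) (x u : E d) :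
    hess (avg F) x u = (n : ℝ)⁻¹ • ∑ i, hess (F i) x u := by
  have h1 : (fun y => gradient (avg F) y) = fun y => (n : ℝ)⁻¹ • ∑ i, gradient (F i) y :=
    funext fun y => gradient_avg hF y
  rw [hess, h1, fderiv_fun_const_smul, fderiv_fun_sum]
  · simp [hess]
  · exact fun i _ => hF' i x
  · exact DifferentiableAt.fun_sum fun i _ => hF' i x

theorem IsSmooth.avg {L : ℝ} (hL : 0 ≤ L) {F : Fin n → E d → ℝ} (hF : ∀ i, IsSmooth L (F i)) :
    IsSmooth L (NCD3.avg F) := by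
  refine ⟨?_, fun x y => ?_⟩
  · unfold NCD3.avg
    exact (Differentiable.fun_sum fun i _ => (hF i).1).const_mul _
  · rw [gradient_avg fun i => (hF i).1, gradient_avg fun i => (hF i).1, ← smul_sub,
      ← Finset.sum_sub_distrib]
    exact norm_inv_smul_sum_le (by positivity) fun i => (hF i).2 x y

theorem IsSmooth.norm_hess_apply_le {L : ℝ} (hL : 0 ≤ L) {f : E d → ℝ} (hf : IsSmooth L f)
    (x u : E d) : ‖hess f x u‖ ≤ L * ‖u‖ := by
  have h : LipschitzWith L.toNNReal fun y => gradient f y :=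
    LipschitzWith.of_dist_le_mul fun y z => by
      rw [dist_eq_norm, dist_eq_norm, Real.coe_toNNReal _ hL]
      exact hf.2 y z
  have h1 : ‖hess f x‖ ≤ L := by
    have := norm_fderiv_le_of_lipschitz ℝ h (x₀ := x)
    rwa [Real.coe_toNNReal _ hL] at this
  exact (hess f x).le_of_opNorm_le h1 u

theorem isSymmetric_hess {f : E d → ℝ} (hf : Differentiable ℝ f)
    (hf' : Differentiable ℝ fun y => gradient f y) (x : E d) :
    (hess f x : E d →ₗ[ℝ] E d).IsSymmetric := by
  let B : E d →L[ℝ] E d →L[ℝ] ℝ := isBoundedBilinearMap_inner.toContinuousLinearMap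
  have hB : ∀ u v, B u v = inner ℝ u v := fun u v => rfl
  have h1 : ∀ y, HasFDerivAt f (B (gradient f y)) y := fun y => by
    have : B (gradient f y) = fderiv ℝ f y := by
      ext v
      rw [hB, inner_gradient_left]
    rw [this]
    exact (hf y).hasFDerivAt
  have h2 : HasFDerivAt (fun y => B (gradient f y)) (B.comp (hess f x)) x :=
    B.hasFDerivAt.comp x (hf' x).hasFDerivAt
  intro u v
  have h3 := second_derivative_symmetric h1 h2 u v
  simp only [ContinuousLinearMap.comp_apply, hB] at h3
  change inner ℝ (hess f x u) v = inner ℝ u (hess f x v)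
  rw [h3, real_inner_comm]

theorem approx_hess_of_lipschitz {L h : ℝ} (hL : 0 ≤ L) (hh : 0 < h) {f : E d → ℝ}
    (hf : IsHessianLipschitz L f) (x u : E d) :
    ‖(‖u‖ / h) • (gradient f (x + (h / ‖u‖) • u) - gradient f x) - hess f x u‖ ≤
      L * h * ‖u‖ := by
  rcases eq_or_ne u 0 with rfl | hu
  · simp
  have hu0 : 0 < ‖u‖ := norm_pos_iff.2 hu
  set p := (h / ‖u‖) • u with hp
  have hpn : ‖p‖ = h := by
    rw [hp, norm_smul, Real.norm_of_nonneg (by positivity)]; field_simp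
  have hup : u = (‖u‖ / h) • p := by
    rw [hp, smul_smul, div_mul_div_comm, mul_comm, div_self (by positivity), one_smul]
  have h1 : ‖gradient f (x + p) - gradient f x - hess f x (x + p - x)‖ ≤ L * h * ‖x + p - x‖ := by
    refine (convex_closedBall x h).norm_image_sub_le_of_norm_hasFDerivWithin_le'
      (f := fun y => gradient f y) (f' := fun y => hess f y)
      (fun y _ => (hf.2.1 y).hasFDerivAt.hasFDerivWithinAt) (fun y hy => ?_)
      (Metric.mem_closedBall_self hh.le) (by simp [hpn])
    refine (hf.2.2 y x).trans ?_
    gcongr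
    rwa [← dist_eq_norm]
  rw [add_sub_cancel_left, hpn] at h1
  have h2 : hess f x u = (‖u‖ / h) • hess f x p := by
    conv_lhs => rw [hup]
    rw [map_smul]
  rw [h2, ← smul_sub, norm_smul, Real.norm_of_nonneg (by positivity)]
  calc ‖u‖ / h * ‖gradient f (x + p) - gradient f x - hess f x p‖
      ≤ ‖u‖ / h * (L * h * h) := by gcongr
    _ = L * h * ‖u‖ := by field_simp

end Hessian

/-! ### The smallest eigenvalue -/

section LambdaMin

variable {d : ℕ} {T : E d →L[ℝ] E d}

theorem neg_le_lambdaMin {L : ℝ} (hL : 0 ≤ L) (hT : ∀ u, ‖T u‖ ≤ L * ‖u‖) : -L ≤ lambdaMin T := by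
  refine Real.le_sInf (fun μ hμ => ?_) (by linarith)
  obtain ⟨v, hv⟩ := Module.End.HasEigenvalue.exists_hasEigenvector hμ
  have h1 : T v = μ • v := hv.apply_eq_smul
  have h2 := hT v
  rw [h1, norm_smul, Real.norm_eq_abs] at h2
  have h3 := le_of_mul_le_mul_right h2 (norm_pos_iff.2 hv.2)
  linarith [neg_abs_le μ]

theorem exists_eigenbasis (hT : (T : E d →ₗ[ℝ] E d).IsSymmetric) :
    ∃ (b : OrthonormalBasis (Fin d) ℝ (E d)) (lam : Fin d → ℝ), (∀ i, T (b i) = lam i • b i) ∧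
      (∀ i, lambdaMin T ≤ lam i) ∧ (lambdaMin T < 0 → ∃ i, lam i ≤ lambdaMin T) := by
  have hd : Module.finrank ℝ (E d) = d := by simp
  set b := hT.eigenvectorBasis hd with hb
  set lam := hT.eigenvalues hd with hlam
  have hTb : ∀ i, T (b i) = lam i • b i := fun i => by
    exact hT.apply_eigenvectorBasis hd i
  refine ⟨b, lam, hTb, fun i => ?_, fun hneg => ?_⟩
  · refine csInf_le ⟨-‖T‖, fun μ hμ => ?_⟩ (hT.hasEigenvalue_eigenvalues hd i)
    obtain ⟨v, hv⟩ := Module.End.HasEigenvalue.exists_hasEigenvector hμ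
    have h1 : T v = μ • v := hv.apply_eq_smul
    have h2 := T.le_opNorm v
    rw [h1, norm_smul, Real.norm_eq_abs] at h2
    have h3 := le_of_mul_le_mul_right h2 (norm_pos_iff.2 hv.2)
    linarith [neg_abs_le μ]
  · rcases isEmpty_or_nonempty (Fin d) with he | hne
    · have hE : ∀ v : E d, v = 0 := fun v => by ext i; exact he.elim i
      have hempty : {μ : ℝ | Module.End.HasEigenvalue (T : E d →ₗ[ℝ] E d) μ} = ∅ := by
        ext μ
        simp only [Set.mem_ofPred_eq, Set.mem_empty_iff_false, iff_false]
        intro hμ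
        obtain ⟨v, hv⟩ := Module.End.HasEigenvalue.exists_hasEigenvector hμ
        exact hv.2 (hE v)
      rw [lambdaMin, hempty, Real.sInf_empty] at hneg
      exact absurd hneg (lt_irrefl 0)
    · obtain ⟨i, hi⟩ := Finite.exists_min lam
      refine ⟨i, le_csInf ⟨_, hT.hasEigenvalue_eigenvalues hd i⟩ fun μ hμ => ?_⟩
      obtain ⟨v, hv⟩ := Module.End.HasEigenvalue.exists_hasEigenvector hμ
      have h1 : T v = μ • v := hv.apply_eq_smul
      have h2 := inner_apply_eq_sum b hTb v
      rw [h1, inner_smul_right, real_inner_self_eq_norm_sq] at h2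
      have h3 : lam i * ‖v‖ ^ 2 ≤ μ * ‖v‖ ^ 2 := by
        rw [h2, norm_sq_eq_sum_inner b v, Finset.mul_sum]
        exact Finset.sum_le_sum fun j _ => by gcongr; exact hi j
      exact le_of_mul_le_mul_right h3 (by have := norm_pos_iff.2 hv.2; positivity)

end LambdaMin

/-! ### The search over all scales -/

section Search

variable {Q R : Type} {d n : ℕ}

/-- The number of dyadic scales `ε, 2ε, 4ε, …` that are searched. -/
def numScales (D : ℝ) : ℕ := ⌊2 * Real.log D⌋₊ + 1

/-- The search for a direction of negative curvature below `-ε/2`: at each scale `s = 2ʲε` a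
candidate is computed by the Chebyshev iteration, and the first candidate whose Rayleigh quotient,
computed with error at most `τ`, certifies its curvature is returned. -/
def ncSearch [NeZero n] (hv : Fin n → E d → Prog Q R (E d)) (L ε D τ : ℝ) :
    RandAlg Q R (Option (E d)) where
  Ω := (j : Fin (numScales D)) → ScaleSeed d n L D (2 ^ (j : ℕ) * ε)
  mΩ := inferInstance
  P := Measure.pi fun _ => ProbabilityTheory.uniformOn Set.univ
  prob := by
    have : ∀ j : Fin (numScales D), IsProbabilityMeasure (ProbabilityTheory.uniformOn
        (Set.univ : Set (ScaleSeed d n L D (2 ^ (j : ℕ) * ε)))) := fun j =>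
      ProbabilityTheory.isProbabilityMeasure_uniformOn Set.finite_univ Set.univ_nonempty
    infer_instance
  prog ω := firstSome fun j =>
    (chebyshevProg hv (2 * (2 ^ (j : ℕ) * ε) + reg n L (2 ^ (j : ℕ) * ε))
      (reg n L (2 ^ (j : ℕ) * ε) / (16 * (4 * L) ^ 2))
      (5 / 4 * (2 ^ (j : ℕ) * ε) + reg n L (2 ^ (j : ℕ) * ε)) (768 * n) (numEpochs D)
      (numSteps n L D (2 ^ (j : ℕ) * ε)) (gridVec (ω j).1) (ω j).2).bind
        (testProg hv (ε / 2 + τ))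

variable {hv : Fin n → E d → Prog Q R (E d)} {O : Q → R} {A : Fin n → E d →L[ℝ] E d} {f : E d → ℝ}
  {x : E d} {L τ ε D δ : ℝ}

theorem exists_scale (hε : 0 < ε) (hLε : L / ε ≤ D) {μ : ℝ} (hμ : ε < μ)
    (hμL : μ ≤ L) : ∃ j : Fin (numScales D), 2 ^ (j : ℕ) * ε ≤ μ ∧ μ ≤ 2 * (2 ^ (j : ℕ) * ε) := by
  obtain ⟨j, h1, h2⟩ := exists_nat_pow_near (x := μ / ε) (y := 2)
    (by rw [le_div_iff₀ hε]; linarith) (by norm_num)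
  rw [le_div_iff₀ hε] at h1
  rw [div_lt_iff₀ hε, pow_succ] at h2
  have hj : j < numScales D := by
    have h3 : (2 : ℝ) ^ j ≤ D := by
      refine le_trans ?_ hLε
      rw [le_div_iff₀ hε]; linarith
    have h4 := Real.log_le_log (by positivity) h3
    rw [Real.log_pow] at h4
    have h5 : (1 : ℝ) / 2 ≤ Real.log 2 := by linarith [Real.log_two_gt_d9]
    have h6 : (j : ℝ) * (1 / 2) ≤ j * Real.log 2 := by gcongr
    rw [numScales, Nat.lt_add_one_iff]
    exact Nat.le_floor (by linarith)
  exact ⟨⟨j, hj⟩, h1, by simp only; linarith⟩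

theorem abs_inner_avgMap_sub_le {g : Fin n → E d → E d} {H : E d →L[ℝ] E d}
    (h : ApproxFamily g A H L τ) (hτ : 0 ≤ τ) {v : E d} (hv1 : ‖v‖ = 1) :
    |inner ℝ v (avgMap g v) - inner ℝ v (H v)| ≤ τ := by
  rw [← inner_sub_right]
  refine (abs_real_inner_le_norm _ _).trans ?_
  rw [hv1, one_mul]
  simpa [hv1] using h.norm_avgMap_sub_le hτ v

theorem isApproxNC_ncSearch [NeZero n]
    (h : ApproxFamily (fun i u => (hv i u).result O) A (hess f x) L τ) (hτ : 0 ≤ τ)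
    (hsym : (hess f x : E d →ₗ[ℝ] E d).IsSymmetric) (hε : 0 < ε) (hεL : ε ≤ L) (hD : 11 ≤ D)
    (hdD : d ≤ D) (hLε : L / ε ≤ D) (hδ : 0 < δ) (hδD : 1 / δ ≤ D) (hτε : τ ≤ ε * (D ^ 182)⁻¹) :
    IsApproxNC (ncSearch hv L ε D τ) O f x ε δ := by
  have hL : 0 < L := hε.trans_le hεL
  have hsound : ∀ ω v, (ncSearch hv L ε D τ).output O ω = some v →
      ‖v‖ = 1 ∧ inner ℝ v (hess f x v) ≤ -ε / 2 := by
    intro ω v hω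
    obtain ⟨j, hj⟩ := result_firstSome_eq_some hω
    rw [Prog.result_bind] at hj
    obtain ⟨h1, h2⟩ := result_testProg_eq_some hj
    refine ⟨h1, ?_⟩
    have := (abs_le.1 (abs_inner_avgMap_sub_le h hτ h1)).1
    linarith
  refine ⟨fun s _ => ?_, fun ω v hω => (hsound ω v hω).1, ?_⟩
  · change MeasurableSet (α := (j : Fin (numScales D)) → ScaleSeed d n L D (2 ^ (j : ℕ) * ε)) _
    exact MeasurableSet.of_discrete
  rcases le_or_gt (-ε) (lambdaMin (hess f x)) with hlam | hlam
  · have : {ω | ((ncSearch hv L ε D τ).output O ω = none ∧ -ε ≤ lambdaMin (hess f x)) ∨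
        ∃ v, (ncSearch hv L ε D τ).output O ω = some v ∧ inner ℝ v (hess f x v) ≤ -ε / 2} =
        Set.univ := by
      refine Set.eq_univ_of_forall fun ω => ?_
      rcases ho : (ncSearch hv L ε D τ).output O ω with _ | v
      · exact .inl ⟨ho, hlam⟩
      · exact .inr ⟨v, ho, (hsound ω v ho).2⟩
    rw [this, probReal_univ]
    linarith
  obtain ⟨b, lam, hb, hmin, hex⟩ := exists_eigenbasis hsym
  obtain ⟨i₀, hi₀⟩ := hex (by linarith)
  have hμL : -lambdaMin (hess f x) ≤ L := by
    linarith [neg_le_lambdaMin hL.le (h.norm_apply_le hL.le)]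
  obtain ⟨j, hj1, hj2⟩ := exists_scale hε hLε (μ := -lambdaMin (hess f x)) (by linarith) hμL
  set s := 2 ^ (j : ℕ) * ε with hs
  have hεs : ε ≤ s := le_mul_of_one_le_left hε.le (one_le_pow₀ (by norm_num))
  have hs0 : 0 < s := hε.trans_le hεs
  have hlamL : ∀ i, lam i ≤ L := fun i => by
    have h1 := h.norm_apply_le hL.le (b i)
    rw [hb, norm_smul, b.norm_eq_one, mul_one, mul_one] at h1
    exact (le_abs_self _).trans h1
  classical
  have hprob := expect_scaleVec_fail_le h hτ hs0 (hj1.trans hμL) hD hdD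
    ((show L / s ≤ L / ε by gcongr).trans hLε) hδ hδD (hτε.trans (by gcongr)) b hb hlamL
    (fun i => by linarith [hmin i]) (i₀ := i₀) (by linarith)
  set q : ScaleSeed d n L D s → Prop := fun ω =>
    scaleVec (fun i u => (hv i u).result O) L D s ω ≠ 0 ∧
      inner ℝ (scaleVec (fun i u => (hv i u).result O) L D s ω)
        (hess f x (scaleVec (fun i u => (hv i u).result O) L D s ω)) ≤
        -(3 / 5 * s) * ‖scaleVec (fun i u => (hv i u).result O) L D s ω‖ ^ 2 with hq
  have hreal := real_uniformOn_univ q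
  have hP : ∀ j : Fin (numScales D), IsProbabilityMeasure (ProbabilityTheory.uniformOn
      (Set.univ : Set (ScaleSeed d n L D (2 ^ (j : ℕ) * ε)))) := fun j =>
    ProbabilityTheory.isProbabilityMeasure_uniformOn Set.finite_univ Set.univ_nonempty
  have hmp := measurePreserving_eval (fun j : Fin (numScales D) => ProbabilityTheory.uniformOn
      (Set.univ : Set (ScaleSeed d n L D (2 ^ (j : ℕ) * ε)))) j
  have hmarg : (ncSearch hv L ε D τ).P.real (Function.eval j ⁻¹' {ω | q ω}) =
      (ProbabilityTheory.uniformOn (Set.univ : Set (ScaleSeed d n L D s))).real {ω | q ω} := by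
    rw [measureReal_def, measureReal_def]
    congr 1
    exact hmp.measure_preimage (MeasurableSet.of_discrete).nullMeasurableSet
  calc 1 - δ ≤ (ncSearch hv L ε D τ).P.real (Function.eval j ⁻¹' {ω | q ω}) := by
        rw [hmarg, hreal]
        refine sub_le_sub_left ?_ 1
        convert hprob
    _ ≤ _ := measureReal_mono fun ω hω => ?_
  have hω : q (ω j) := hω
  obtain ⟨hy0, hy⟩ := hω
  have hne : (ncSearch hv L ε D τ).output O ω ≠ none := by
    refine result_firstSome_ne_none (j := j) ?_
    rw [Prog.result_bind, result_chebyshevProg]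
    set y := scaleVec (fun i u => (hv i u).result O) L D s (ω j) with hydef
    refine result_testProg_ne_none (y := y) hy0 ?_
    have hyn : 0 < ‖y‖ := norm_pos_iff.2 hy0
    have h1 : ‖‖y‖⁻¹ • y‖ = 1 := by
      rw [norm_smul, norm_inv, norm_norm, inv_mul_cancel₀ hyn.ne']
    have h2 := (abs_le.1 (abs_inner_avgMap_sub_le h hτ h1)).2
    have h3 : inner ℝ (‖y‖⁻¹ • y) (hess f x (‖y‖⁻¹ • y)) ≤ -(3 / 5 * s) := by
      rw [map_smul, inner_smul_left, inner_smul_right]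
      simp only [conj_trivial]
      calc ‖y‖⁻¹ * (‖y‖⁻¹ * inner ℝ y (hess f x y))
          ≤ ‖y‖⁻¹ * (‖y‖⁻¹ * (-(3 / 5 * s) * ‖y‖ ^ 2)) := by gcongr
        _ = -(3 / 5 * s) := by field_simp
    have h4 : τ ≤ ε / 20 := by
      refine hτε.trans ?_
      rw [div_eq_mul_inv]
      gcongr
      calc (20 : ℝ) ≤ 11 ^ 2 := by norm_num
        _ ≤ D ^ 2 := by gcongr
        _ ≤ D ^ 182 := pow_le_pow_right₀ (by linarith) (by norm_num)
    linarith
  obtain ⟨v, hv'⟩ := Option.ne_none_iff_exists'.1 hne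
  exact .inr ⟨v, hv', (hsound ω v hv').2⟩

theorem mul_sqrt_reg_div_le [NeZero n] {s : ℝ} (hε : 0 < ε) (hεs : ε ≤ s) (hL : 0 ≤ L) :
    n * √(reg n L s / s) ≤ n + (n : ℝ) ^ (3 / 4 : ℝ) * √(L / ε) := by
  have hn : (0 : ℝ) < n := by exact_mod_cast Nat.pos_of_ne_zero (NeZero.ne n)
  have hs : 0 < s := hε.trans_le hεs
  rcases le_total (L / √n) s with h | h
  · rw [reg, max_eq_left h, div_self hs.ne', Real.sqrt_one, mul_one]
    have : 0 ≤ (n : ℝ) ^ (3 / 4 : ℝ) * √(L / ε) := by positivity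
    linarith
  · rw [reg, max_eq_right h]
    have h1 : L / √n / s ≤ L / ε / √n := by
      rw [div_right_comm]; gcongr
    have h2 : √(L / √n / s) ≤ √(L / ε) / √(√n) := by
      rw [← Real.sqrt_div (by positivity)]
      exact Real.sqrt_le_sqrt h1
    have h3 : (n : ℝ) / √(√n) = (n : ℝ) ^ (3 / 4 : ℝ) := by
      rw [Real.sqrt_eq_rpow, Real.sqrt_eq_rpow, ← Real.rpow_mul hn.le]
      nth_rewrite 1 [← Real.rpow_one (n : ℝ)]
      rw [← Real.rpow_sub hn]
      norm_num
    calc n * √(L / √n / s) ≤ n * (√(L / ε) / √(√n)) := by gcongr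
      _ = (n : ℝ) / √(√n) * √(L / ε) := by ring
      _ = (n : ℝ) ^ (3 / 4 : ℝ) * √(L / ε) := by rw [h3]
      _ ≤ _ := by linarith

theorem calls_ncSearch_le [NeZero n] (hc : ∀ i u, (hv i u).calls O ≤ 2) (hε : 0 < ε) (hL : 0 ≤ L)
    (hD : 11 ≤ D) (ω : (ncSearch hv L ε D τ).Ω) :
    ((ncSearch hv L ε D τ).calls O ω : ℝ) ≤
      140000000 * (n + (n : ℝ) ^ (3 / 4 : ℝ) * √(L / ε)) * Real.log D ^ 3 := by
  set W := (n : ℝ) + (n : ℝ) ^ (3 / 4 : ℝ) * √(L / ε) with hW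
  set l := Real.log D with hl
  have hl1 : 1 ≤ l := one_le_log hD
  have hnW : (n : ℝ) ≤ W := le_add_of_nonneg_right (by positivity)
  have hW0 : 0 ≤ W := le_trans (by positivity) hnW
  set M : ℕ := ⌊46000000 * l ^ 2 * W⌋₊ with hM
  have hscale : ∀ j : Fin (numScales D), numSteps n L D (2 ^ (j : ℕ) * ε) *
      (numEpochs D * (n * 2 + 768 * n * 2)) + n * 2 ≤ M := by
    intro j
    refine Nat.le_floor ?_
    push_cast
    set s := 2 ^ (j : ℕ) * ε with hs
    have hεs : ε ≤ s := le_mul_of_one_le_left hε.le (one_le_pow₀ (by norm_num))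
    have h1 := numSteps_le (n := n) (L := L) hD (hε.trans_le hεs)
    have h2 : (numEpochs D : ℝ) ≤ 725 * l := by
      have := Nat.ceil_lt_add_one (a := 724 * l) (by positivity)
      rw [numEpochs]; linarith
    have h3 := mul_sqrt_reg_div_le (n := n) hε hεs hL
    calc (numSteps n L D s : ℝ) * (numEpochs D * (n * 2 + 768 * n * 2)) + n * 2
        ≤ (41 * l * √(reg n L s / s)) * (725 * l * (n * 2 + 768 * n * 2)) + n * 2 := by
          gcongr
      _ = 45717050 * l ^ 2 * (n * √(reg n L s / s)) + n * 2 := by ring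
      _ ≤ 45717050 * l ^ 2 * W + 1 * W * 2 := by
          rw [one_mul]
          gcongr
      _ ≤ 45717050 * l ^ 2 * W + l ^ 2 * W * 2 := by
          gcongr
          exact one_le_pow₀ hl1
      _ ≤ 46000000 * l ^ 2 * W := by
          have : 0 ≤ l ^ 2 * W := by positivity
          linarith
  have hcalls : (ncSearch hv L ε D τ).calls O ω ≤ numScales D * M := by
    refine calls_firstSome_le fun j => ?_
    rw [Prog.calls_bind]
    exact (Nat.add_le_add (calls_chebyshevProg_le hc _ _ _ _ _ _ _ _)
      (calls_testProg_le hc _ _)).trans (hscale j)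
  have hJ : (numScales D : ℝ) ≤ 3 * l := by
    have := Nat.floor_le (a := 2 * l) (by positivity)
    rw [numScales]; push_cast; linarith
  have hM' : (M : ℝ) ≤ 46000000 * l ^ 2 * W := Nat.floor_le (by positivity)
  calc ((ncSearch hv L ε D τ).calls O ω : ℝ) ≤ ((numScales D * M : ℕ) : ℝ) := by
        exact_mod_cast hcalls
    _ = numScales D * (M : ℝ) := by push_cast; ring
    _ ≤ 3 * l * (46000000 * l ^ 2 * W) := by gcongr
    _ = 138000000 * W * l ^ 3 := by ring
    _ ≤ _ := by gcongr; norm_num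

end Search

/-! ### The two implementations of the subroutine -/

section Implementation

variable {Q R : Type} {d n : ℕ}

/-- The algorithm that returns `⊥` without any oracle call. -/
def trivialAlg (Q R : Type) (d : ℕ) : RandAlg Q R (Option (E d)) where
  Ω := Unit
  mΩ := inferInstance
  P := Measure.dirac ()
  prob := inferInstance
  prog _ := .ret none

theorem isApproxNC_trivialAlg {O : Q → R} {f : E d → ℝ} {x : E d} {ε δ : ℝ}
    (h : -ε ≤ lambdaMin (hess f x)) (hδ : 0 ≤ δ) :
    IsApproxNC (trivialAlg Q R d) O f x ε δ := by
  refine ⟨fun s _ => ?_, fun ω v hω => by simp [RandAlg.output, trivialAlg] at hω, ?_⟩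
  · change MeasurableSet (α := Unit) _
    exact MeasurableSet.of_discrete
  · have : {ω | ((trivialAlg Q R d).output O ω = none ∧ -ε ≤ lambdaMin (hess f x)) ∨
        ∃ v, (trivialAlg Q R d).output O ω = some v ∧ inner ℝ v (hess f x v) ≤ -ε / 2} =
        Set.univ := Set.eq_univ_of_forall fun ω => .inl ⟨rfl, h⟩
    rw [this, probReal_univ]
    linarith

/-- A quantity that dominates the dimension, the condition number `L/ε` and the reciprocal of the
failure probability `min δ (ε / (3ε + 8L))`. -/
def sizeBound (d n : ℕ) (L ε δ : ℝ) : ℝ := 11 * (2 + n * d * L / (ε * δ))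

/-- The relative accuracy required of the computed Hessian-vector products. -/
def hvpAccuracy (d n : ℕ) (L ε δ : ℝ) : ℝ := ε * (sizeBound d n L ε δ ^ 182)⁻¹

open scoped Classical in
/-- ApproxNC, from programs `hv` for Hessian-vector products. No search is needed if `L < ε`, because
then `-L` is a lower bound for the spectrum of the Hessian, or if the problem is empty. -/
def approxNC (hv : Fin n → E d → Prog Q R (E d)) (L ε δ : ℝ) : RandAlg Q R (Option (E d)) :=
  if h : n ≠ 0 ∧ d ≠ 0 ∧ ε ≤ L then
    haveI : NeZero n := ⟨h.1⟩
    ncSearch hv L ε (sizeBound d n L ε δ) (hvpAccuracy d n L ε δ)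
  else trivialAlg Q R d

variable {hv : Fin n → E d → Prog Q R (E d)} {O : Q → R} {F : Fin n → E d → ℝ} {x : E d}
  {L ε δ : ℝ}

theorem one_le_size_term (hn : n ≠ 0) (hd : d ≠ 0) (hε : 0 < ε) (hεL : ε ≤ L) (hδ : 0 < δ)
    (hδ1 : δ < 1) : (d : ℝ) ≤ n * d * L / (ε * δ) ∧ L / ε ≤ n * d * L / (ε * δ) ∧
      1 / δ ≤ n * d * L / (ε * δ) := by
  have hn1 : (1 : ℝ) ≤ n := by exact_mod_cast Nat.one_le_iff_ne_zero.2 hn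
  have hd1 : (1 : ℝ) ≤ d := by exact_mod_cast Nat.one_le_iff_ne_zero.2 hd
  have hκ : 1 ≤ L / ε := by rwa [one_le_div hε]
  have hδi : 1 ≤ 1 / δ := by rw [one_le_div hδ]; exact hδ1.le
  have e : (n : ℝ) * d * L / (ε * δ) = n * d * (L / ε) * (1 / δ) := by field_simp
  rw [e]
  have h1 : (1 : ℝ) ≤ n * d := one_le_mul_of_one_le_of_one_le hn1 hd1
  refine ⟨?_, ?_, ?_⟩
  · calc (d : ℝ) = 1 * d * 1 * 1 := by ring
      _ ≤ n * d * (L / ε) * (1 / δ) := by gcongr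
  · calc L / ε = 1 * (L / ε) * 1 := by ring
      _ ≤ n * d * (L / ε) * (1 / δ) := by gcongr
  · calc 1 / δ = 1 * 1 * (1 / δ) := by ring
      _ ≤ n * d * (L / ε) * (1 / δ) := by gcongr

theorem eleven_le_sizeBound (hL : 0 < L) (hε : 0 < ε) (hδ : 0 < δ) :
    11 ≤ sizeBound d n L ε δ := by
  have : 0 ≤ (n : ℝ) * d * L / (ε * δ) := by positivity
  rw [sizeBound]
  linarith

theorem hvpAccuracy_pos (hL : 0 < L) (hε : 0 < ε) (hδ : 0 < δ) : 0 < hvpAccuracy d n L ε δ := by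
  have := eleven_le_sizeBound (d := d) (n := n) hL hε hδ
  rw [hvpAccuracy]
  positivity

theorem isApproxNC_approxNC (hL : 0 < L) (hε : 0 < ε) (hδ : 0 < δ) (hδ1 : δ < 1)
    (hF : ∀ i, IsSmooth L (F i)) (hF' : ∀ i, Differentiable ℝ fun y => gradient (F i) y)
    (hhv : ∀ i u, ‖(hv i u).result O - hess (F i) x u‖ ≤ hvpAccuracy d n L ε δ * ‖u‖) :
    IsApproxNC (approxNC hv L ε δ) O (avg F) x ε (min δ (ε / (3 * ε + 8 * L))) := by
  classical
  have hδ' : 0 < min δ (ε / (3 * ε + 8 * L)) := lt_min hδ (by positivity)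
  have hfam : ApproxFamily (fun i u => (hv i u).result O) (fun i => hess (F i) x)
      (hess (avg F) x) L (hvpAccuracy d n L ε δ) :=
    ⟨fun i u => (hF i).norm_hess_apply_le hL.le x u, hhv,
      fun u => hess_avg (fun i => (hF i).1) hF' x u⟩
  have hsm : IsSmooth L (avg F) := IsSmooth.avg hL.le hF
  by_cases h : n ≠ 0 ∧ d ≠ 0 ∧ ε ≤ L
  · rw [approxNC, dif_pos h]
    obtain ⟨hn, hd, hεL⟩ := h
    have : NeZero n := ⟨hn⟩
    obtain ⟨h1, h2, h3⟩ := one_le_size_term hn hd hε hεL hδ hδ1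
    have hS : sizeBound d n L ε δ = 11 * (2 + n * d * L / (ε * δ)) := rfl
    have hdiff : Differentiable ℝ fun y => gradient (avg F) y := by
      have e : (fun y => gradient (avg F) y) = fun y => (n : ℝ)⁻¹ • ∑ i, gradient (F i) y :=
        funext fun y => gradient_avg (fun i => (hF i).1) y
      rw [e]
      have hsum : Differentiable ℝ fun y => ∑ i, gradient (F i) y :=
        Differentiable.fun_sum fun i _ => hF' i
      exact hsum.const_smul (n : ℝ)⁻¹
    refine isApproxNC_ncSearch hfam (hvpAccuracy_pos hL hε hδ).le
      (isSymmetric_hess hsm.1 hdiff x) hε hεL (eleven_le_sizeBound hL hε hδ) ?_ ?_ hδ' ?_ le_rfl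
    · linarith [show (0 : ℝ) ≤ d by positivity]
    · linarith [show (0 : ℝ) ≤ L / ε by positivity]
    · have h4 : 1 / δ ≤ sizeBound d n L ε δ := by
        linarith [show (0 : ℝ) ≤ 1 / δ by positivity]
      have h5 : 1 / (ε / (3 * ε + 8 * L)) ≤ sizeBound d n L ε δ := by
        have e : 1 / (ε / (3 * ε + 8 * L)) = 3 + 8 * (L / ε) := by field_simp
        rw [e]
        linarith [show (0 : ℝ) ≤ L / ε by positivity]
      rcases min_choice δ (ε / (3 * ε + 8 * L)) with hm | hm <;> rw [hm] <;> assumption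
  · rw [approxNC, dif_neg h]
    refine isApproxNC_trivialAlg ?_ hδ'.le
    have hzero : (∀ u, hess (avg F) x u = 0) → -ε ≤ lambdaMin (hess (avg F) x) := fun h0 => by
      have := neg_le_lambdaMin (T := hess (avg F) x) le_rfl fun u => by rw [h0]; simp
      linarith
    by_cases hn : n = 0
    · refine hzero fun u => ?_
      subst hn
      rw [hfam.avg]; simp
    by_cases hd : d = 0
    · refine hzero fun u => ?_
      subst hd
      exact Subsingleton.elim _ _
    · have hεL : L < ε := by
        by_contra! hcon
        exact h ⟨hn, hd, hcon⟩
      linarith [neg_le_lambdaMin hL.le fun u => hsm.norm_hess_apply_le hL.le x u]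

theorem calls_approxNC_le (hc : ∀ i u, (hv i u).calls O ≤ 2) (hL : 0 < L) (hε : 0 < ε)
    (hδ : 0 < δ) (hδ1 : δ < 1) (ω : (approxNC hv L ε δ).Ω) :
    ((approxNC hv L ε δ).calls O ω : ℝ) ≤ complexityBound 10000000000 3 d n L ε δ := by
  classical
  set X := 2 + (n : ℝ) * d * L / (ε * δ) with hX
  have hX2 : 2 ≤ X := le_add_of_nonneg_right (by positivity)
  have hlog0 : 0 ≤ Real.log X := Real.log_nonneg (by linarith)
  have key : ∀ A : RandAlg Q R (Option (E d)), A = approxNC hv L ε δ → ∀ ω : A.Ω,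
      (A.calls O ω : ℝ) ≤ complexityBound 10000000000 3 d n L ε δ := by
    intro A hA ω
    by_cases h : n ≠ 0 ∧ d ≠ 0 ∧ ε ≤ L
    · rw [approxNC, dif_pos h] at hA
      subst hA
      obtain ⟨hn, hd, hεL⟩ := h
      have : NeZero n := ⟨hn⟩
      have hX3 : 3 ≤ X := by
        have h1 := (one_le_size_term hn hd hε hεL hδ hδ1).2.1
        have h2 : 1 ≤ L / ε := by rwa [one_le_div hε]
        linarith
      have hlog : Real.log (sizeBound d n L ε δ) ≤ 4 * Real.log X := by
        have h1 : sizeBound d n L ε δ ≤ X ^ 4 := by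
          have h3 : (11 : ℝ) ≤ X ^ 3 := by
            calc (11 : ℝ) ≤ 3 ^ 3 := by norm_num
              _ ≤ X ^ 3 := by gcongr
          calc sizeBound d n L ε δ = 11 * X := rfl
            _ ≤ X ^ 3 * X := by gcongr
            _ = X ^ 4 := by ring
        have h2 := Real.log_le_log
          (by linarith [eleven_le_sizeBound (d := d) (n := n) hL hε hδ]) h1
        rw [Real.log_pow] at h2
        exact_mod_cast h2
      have hl0 : 0 ≤ Real.log (sizeBound d n L ε δ) :=
        Real.log_nonneg (by linarith [eleven_le_sizeBound (d := d) (n := n) hL hε hδ])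
      refine (calls_ncSearch_le hc hε hL.le (eleven_le_sizeBound hL hε hδ) ω).trans ?_
      set W := (n : ℝ) + (n : ℝ) ^ (3 / 4 : ℝ) * √(L / ε) with hW
      have hW0 : 0 ≤ W := by positivity
      calc 140000000 * W * Real.log (sizeBound d n L ε δ) ^ 3
          ≤ 140000000 * W * (4 * Real.log X) ^ 3 := by gcongr
        _ = 8960000000 * W * Real.log X ^ 3 := by ring
        _ ≤ 10000000000 * W * Real.log X ^ 3 := by gcongr; norm_num
    · rw [approxNC, dif_neg h] at hA
      subst hA
      have h0 : (trivialAlg Q R d).calls O ω = 0 := rfl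
      rw [h0, Nat.cast_zero, complexityBound]
      positivity
  exact key _ rfl ω

/-- The program for Hessian-vector products at `x` with the Hessian-vector oracle. -/
def hvpProg (x : E d) (i : Fin n) (u : E d) : Prog (Fin n × E d × E d) (E d) (E d) :=
  .ask (i, x, u) .ret

/-- The program for approximate Hessian-vector products at `x` with the gradient oracle: a difference
quotient with step `h` in the direction of `u`. It returns `0` for `u = 0`. -/
def diffProg (x : E d) (h : ℝ) (i : Fin n) (u : E d) : Prog (Fin n × E d) (E d) (E d) :=
  .ask (i, x + (h / ‖u‖) • u) fun a => .ask (i, x) fun b => .ret ((‖u‖ / h) • (a - b))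

theorem IsApproxNC.mono {A : RandAlg Q R (Option (E d))} {f : E d → ℝ} {δ' : ℝ}
    (h : IsApproxNC A O f x ε δ') (hle : δ' ≤ δ) : IsApproxNC A O f x ε δ :=
  ⟨h.measurable, h.unit, le_trans (by linarith) h.success⟩

/-- The expected decrease holds for every admissible `δ`, because the search is run with failure
probability at most `ε / (3ε + 8L)`. -/
theorem approxNC_spec (hc : ∀ i u, (hv i u).calls O ≤ 2) (hL : 0 < L) (hε : 0 < ε) (hδ : 0 < δ)
    (hδ1 : δ < 1) (hF : ∀ i, IsSmooth L (F i))
    (hF' : ∀ i, Differentiable ℝ fun y => gradient (F i) y)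
    (hhv : ∀ i u, ‖(hv i u).result O - hess (F i) x u‖ ≤ hvpAccuracy d n L ε δ * ‖u‖) :
    IsApproxNC (approxNC hv L ε δ) O (avg F) x ε δ ∧ ∀ L₃ : ℝ, 0 < L₃ →
      (∀ s, ((ncd3 L₃ ε x (approxNC hv L ε δ)).calls O s : ℝ) ≤
        complexityBound 10000000000 3 d n L ε δ) ∧
      (IsThirdLipschitz L₃ (avg F) → lambdaMin (hess (avg F) x) < -ε →
        DecreasesWithProb (approxNC hv L ε δ) O (avg F) x L₃ ε δ ∧
        DecreasesInExpectation (approxNC hv L ε δ) O (avg F) x L₃ ε) := by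
  have h := isApproxNC_approxNC hL hε hδ hδ1 hF hF' hhv
  have hA := h.mono (min_le_left _ _)
  refine ⟨hA, fun L₃ hL₃ => ⟨fun s => ?_, fun h3 hlam => ⟨?_, ?_⟩⟩⟩
  · rw [calls_ncd3]
    exact calls_approxNC_le hc hL hε hδ hδ1 s.1
  · exact hA.decreasesWithProb hL₃ hε h3 hlam
  · exact h.decreasesInExpectation hL hL₃ hε (IsSmooth.avg hL.le hF) h3 hlam (min_le_right _ _)

end Implementation

end NCD3

end

theorem lemma4p3 :
    -- (1) every implementation of the subroutine, over an arbitrary oracle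
    (∀ (d n : ℕ) (L₁ L₂ L₃ ε δ : ℝ), 0 < L₁ → 0 ≤ L₂ → 0 < L₃ →
      0 < ε → ε < 1 → 0 < δ → δ < 1 →
      ∀ F : Fin n → NCD3.E d → ℝ,
      (∀ i, NCD3.IsSmooth L₁ (F i)) → (∀ i, NCD3.IsHessianLipschitz L₂ (F i)) →
      NCD3.IsThirdLipschitz L₃ (NCD3.avg F) →
      ∀ x : NCD3.E d, NCD3.lambdaMin (NCD3.hess (NCD3.avg F) x) < -ε →
      ∀ (Q R : Type) (O : Q → R) (A : NCD3.RandAlg Q R (Option (NCD3.E d))),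
      NCD3.IsApproxNC A O (NCD3.avg F) x ε δ →
        NCD3.DecreasesWithProb A O (NCD3.avg F) x L₃ ε δ ∧
        (δ ≤ ε / (3 * ε + 8 * L₁) → NCD3.DecreasesInExpectation A O (NCD3.avg F) x L₃ ε) ∧
        ∀ s, (NCD3.ncd3 L₃ ε x A).calls O s = A.calls O s.1) ∧
    -- (2) an implementation with stochastic Hessian-vector products, and its complexity
    (∃ (C : ℝ) (k : ℕ), ∀ (d n : ℕ) (L₁ L₂ ε δ : ℝ), 0 < L₁ → 0 ≤ L₂ →
      0 < ε → ε < 1 → 0 < δ → δ < 1 →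
      ∃ A : NCD3.E d →
          NCD3.RandAlg (Fin n × NCD3.E d × NCD3.E d) (NCD3.E d) (Option (NCD3.E d)),
      ∀ F : Fin n → NCD3.E d → ℝ,
      (∀ i, NCD3.IsSmooth L₁ (F i)) → (∀ i, NCD3.IsHessianLipschitz L₂ (F i)) →
      ∀ x : NCD3.E d,
        NCD3.IsApproxNC (A x) (NCD3.hvpOracle F) (NCD3.avg F) x ε δ ∧
        ∀ L₃ : ℝ, 0 < L₃ →
          (∀ s, ((NCD3.ncd3 L₃ ε x (A x)).calls (NCD3.hvpOracle F) s : ℝ)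
            ≤ NCD3.complexityBound C k d n L₁ ε δ) ∧
          (NCD3.IsThirdLipschitz L₃ (NCD3.avg F) →
            NCD3.lambdaMin (NCD3.hess (NCD3.avg F) x) < -ε →
            NCD3.DecreasesWithProb (A x) (NCD3.hvpOracle F) (NCD3.avg F) x L₃ ε δ ∧
            (δ ≤ ε / (3 * ε + 8 * L₁) ∨ δ ≤ ε / (3 * ε + 8 * L₂) →
              NCD3.DecreasesInExpectation (A x) (NCD3.hvpOracle F) (NCD3.avg F) x L₃ ε))) ∧
    -- (3) an implementation with stochastic gradients only, and its complexity
    (∃ (C : ℝ) (k : ℕ), ∀ (d n : ℕ) (L₁ L₂ ε δ : ℝ), 0 < L₁ → 0 ≤ L₂ →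
      0 < ε → ε < 1 → 0 < δ → δ < 1 →
      ∃ A : NCD3.E d → NCD3.RandAlg (Fin n × NCD3.E d) (NCD3.E d) (Option (NCD3.E d)),
      ∀ F : Fin n → NCD3.E d → ℝ,
      (∀ i, NCD3.IsSmooth L₁ (F i)) → (∀ i, NCD3.IsHessianLipschitz L₂ (F i)) →
      ∀ x : NCD3.E d,
        NCD3.IsApproxNC (A x) (NCD3.gradOracle F) (NCD3.avg F) x ε δ ∧
        ∀ L₃ : ℝ, 0 < L₃ →
          (∀ s, ((NCD3.ncd3 L₃ ε x (A x)).calls (NCD3.gradOracle F) s : ℝ)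
            ≤ NCD3.complexityBound C k d n L₁ ε δ) ∧
          (NCD3.IsThirdLipschitz L₃ (NCD3.avg F) →
            NCD3.lambdaMin (NCD3.hess (NCD3.avg F) x) < -ε →
            NCD3.DecreasesWithProb (A x) (NCD3.gradOracle F) (NCD3.avg F) x L₃ ε δ ∧
            (δ ≤ ε / (3 * ε + 8 * L₁) ∨ δ ≤ ε / (3 * ε + 8 * L₂) →
              NCD3.DecreasesInExpectation (A x) (NCD3.gradOracle F) (NCD3.avg F) x L₃ ε))) := by
  refine ⟨?_, ⟨10000000000, 3, ?_⟩, ⟨10000000000, 3, ?_⟩⟩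
  · intro d n L₁ L₂ L₃ ε δ hL₁ _ hL₃ hε _ _ _ F hF _ h3 x hlam Q R O A hA
    exact ⟨hA.decreasesWithProb hL₃ hε h3 hlam, fun hδ => hA.decreasesInExpectation hL₁ hL₃ hε
      (NCD3.IsSmooth.avg hL₁.le hF) h3 hlam hδ, fun s => NCD3.calls_ncd3 L₃ ε x s⟩
  · intro d n L₁ L₂ ε δ hL₁ _ hε _ hδ hδ1
    refine ⟨fun x => NCD3.approxNC (NCD3.hvpProg x) L₁ ε δ, fun F hF hF2 x => ?_⟩
    obtain ⟨h1, h2⟩ := NCD3.approxNC_spec (hv := NCD3.hvpProg x) (O := NCD3.hvpOracle F) (x := x)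
      (fun i u => by simp [NCD3.hvpProg, NCD3.Prog.calls]) hL₁ hε hδ hδ1 hF (fun i => (hF2 i).2.1)
      fun i u => by
        have := NCD3.hvpAccuracy_pos (d := d) (n := n) hL₁ hε hδ
        simp only [NCD3.hvpProg, NCD3.Prog.result, NCD3.hvpOracle, sub_self, norm_zero]
        positivity
    exact ⟨h1, fun L₃ hL₃ => ⟨(h2 L₃ hL₃).1, fun h3 hlam =>
      ⟨((h2 L₃ hL₃).2 h3 hlam).1, fun _ => ((h2 L₃ hL₃).2 h3 hlam).2⟩⟩⟩
  · intro d n L₁ L₂ ε δ hL₁ hL₂ hε _ hδ hδ1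
    have hτ := NCD3.hvpAccuracy_pos (d := d) (n := n) hL₁ hε hδ
    have hh : 0 < NCD3.hvpAccuracy d n L₁ ε δ / (L₂ + 1) := by positivity
    refine ⟨fun x => NCD3.approxNC
      (NCD3.diffProg x (NCD3.hvpAccuracy d n L₁ ε δ / (L₂ + 1))) L₁ ε δ, fun F hF hF2 x => ?_⟩
    obtain ⟨h1, h2⟩ := NCD3.approxNC_spec (O := NCD3.gradOracle F) (x := x)
      (hv := NCD3.diffProg x (NCD3.hvpAccuracy d n L₁ ε δ / (L₂ + 1)))
      (fun i u => by simp [NCD3.diffProg, NCD3.Prog.calls]) hL₁ hε hδ hδ1 hF (fun i => (hF2 i).2.1)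
      fun i u => by
        refine (NCD3.approx_hess_of_lipschitz hL₂ hh (hF2 i) x u).trans ?_
        gcongr
        rw [← mul_div_assoc, div_le_iff₀ (by positivity)]
        linarith
    exact ⟨h1, fun L₃ hL₃ => ⟨(h2 L₃ hL₃).1, fun h3 hlam =>
      ⟨((h2 L₃ hL₃).2 h3 hlam).1, fun _ => ((h2 L₃ hL₃).2 h3 hlam).2⟩⟩⟩
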